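/- **Setting.** Let $d\ge 1$, let $\Omega\subseteq\mathbb R^d$ be a bounded open set with $\Omega=\operatorname{int}\overline\Omega$ (for instance a bounded polyhedral Lipschitz domain), and let $\mathcal T_h$ be a finite conforming simplicial triangulation of $\overline\Omega$. A side is a $(d-1)$-dimensional face of an element; it is a boundary side if it belongs to exactly one element, and an interior side otherwise. Let $\mathcal L^0(\mathcal T_h)$ and $\mathcal L^1(\mathcal T_h)$ be the spaces of element-wise constant and element-wise affine functions, let $\Pi_h v|_T=\frac1{|T|}\int_T v\,\mathrm dx$ be the projection onto element-wise constants (componentwise for vector fields), and let $\nabla_h$ be the element-wise gradient. Let * $\mathcal S^{1,cr}(\mathcal T_h)$ be the set of $v_h\in\mathcal L^1(\mathcal T_h)$ that are continuous at the barycenter of every interior side (no boundary condition); * $\mathcal RT^0_N(\mathcal T_h)$ be the set of $y_h\in\mathcal L^1(\mathcal T_h)^d$ whose normal component is constant on each side of each element, does not jump across interior sides, and vanishes on $\partial\Omega$. Let $g\in L^2(\Omega)$, $\alpha>0$, $g_h=\Pi_h g$. For $v_h\in\mathcal S^{1,cr}(\mathcal T_h)$ and $y_h\in\mathcal RT^0_N(\mathcal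 T_h)$ put $$I_h^{cr}(v_h)=\|\nabla_h v_h\|_{L^1(\Omega)}+\tfrac\alpha2\|\Pi_hv_h-g_h\|_{L^2(\Omega)}^2,$$ $$D_h^{rt}(y_h)=-I_{K_1(0)}(\Pi_hy_h)-\tfrac1{2\alpha}\|\operatorname{div}y_h+\alpha g_h\|_{L^2(\Omega)}^2+\tfrac\alpha2\|g_h\|_{L^2(\Omega)}^2,$$ where $I_{K_1(0)}(y)=0$ if $|y|\le1$ a.e. in $\Omega$ and $I_{K_1(0)}(y)=+\infty$ otherwise. For $\varepsilon_h\in\mathcal L^0(\mathcal T_h)$ with $0<\varepsilon_h<1$ and $f_\varepsilon(t)=(1-\varepsilon)(t^2+\varepsilon^2)^{1/2}$ put $$I_{h,\varepsilon_h}^{cr}(v_h)=\|f_{\varepsilon_h}(|\nabla_hv_h|)\|_{L^1(\Omega)}+\tfrac\alpha2\|\Pi_hv_h-g_h\|_{L^2(\Omega)}^2 .$$ **Theorem.** The functional $I_h^{cr}$ has a minimizer in $\mathcal S^{1,cr}(\mathcal T_h)$, and each $I_{h,\varepsilon_h}^{cr}$ has exactly one minimizer $u_{h,\varepsilon_h}^{cr}\in\mathcal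 S^{1,cr}(\mathcal T_h)$. Define $$z_{h,\varepsilon_h}^{rt}=\frac{f_{\varepsilon_h}'(|\nabla_hu_{h,\varepsilon_h}^{cr}|)}{|\nabla_hu_{h,\varepsilon_h}^{cr}|}\nabla_hu_{h,\varepsilon_h}^{cr}+\alpha\,\frac{\Pi_hu_{h,\varepsilon_h}^{cr}-g_h}{d}\,\big(\mathrm{id}_{\mathbb R^d}-\Pi_h\mathrm{id}_{\mathbb R^d}\big),$$ where the first term is $0$ on elements with $\nabla_hu_{h,\varepsilon_h}^{cr}=0$. Then, for every sequence of parameters $\varepsilon_h$ as above with $\|\varepsilon_h\|_{L^\infty(\Omega)}\to0$ (the triangulation being fixed), there is $z_h^{rt}\in\mathcal RT^0_N(\mathcal T_h)$ with $|\Pi_hz_h^{rt}|\le1$ a.e. in $\Omega$ such that: 1. all $z_{h,\varepsilon_h}^{rt}$ lie in $\mathcal RT^0_N(\mathcal T_h)$ and, along a subsequence, $z_{h,\varepsilon_h}^{rt}\to z_h^{rt}$ in $\mathcal RT^0_N(\mathcal T_h)$ (a finite-dimensional space; for instance in the norm of $L^\infty(\Omega;\mathbb R^d)$); 2. for every minimizer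 $u_h^{cr}$ of $I_h^{cr}$, $\operatorname{div}z_h^{rt}=\alpha(\Pi_hu_h^{cr}-g_h)$ in $\mathcal L^0(\mathcal T_h)$ and $\Pi_hz_h^{rt}\cdot\nabla_hu_h^{cr}=|\nabla_hu_h^{cr}|$ in $\mathcal L^0(\mathcal T_h)$; 3. $z_h^{rt}$ maximizes $D_h^{rt}$ over $\mathcal RT^0_N(\mathcal T_h)$, and $I_h^{cr}(u_h^{cr})=D_h^{rt}(z_h^{rt})$ for every minimizer $u_h^{cr}$ of $I_h^{cr}$. -/

import Mathlib

open MeasureTheory Filter Topology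

namespace ROF

/-- Euclidean space `ℝ^d`. -/
abbrev Euc (d : ℕ) := EuclideanSpace ℝ (Fin d)

/-- A conforming triangulation of (the closure of) `Ω`: a finite simplicial complex in `ℝ^d` whose
underlying space is `closure Ω`. Conformity, i.e. that two simplices meet in the convex hull of
their common vertices, is part of `Geometry.SimplicialComplex`. -/
structure Triangulation {d : ℕ} (Ω : Set (Euc d)) where
  complex : Geometry.SimplicialComplex ℝ (Euc d)
  finite : complex.faces.Finite
  space_eq : complex.space = closure Ω

namespace Triangulation

variable {d : ℕ} {Ω : Set (Euc d)}

/-- The elements: the `d`-dimensional simplices of the complex, given by their `d + 1` vertices. -/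
def Elem (𝒯 : Triangulation Ω) : Type :=
  {T : Finset (Euc d) // T ∈ 𝒯.complex.faces ∧ T.card = d + 1}

instance (𝒯 : Triangulation Ω) : Finite 𝒯.Elem :=
  (𝒯.finite.subset (fun _ h => h.1)).to_subtype

noncomputable instance (𝒯 : Triangulation Ω) : Fintype 𝒯.Elem := Fintype.ofFinite _

variable {𝒯 : Triangulation Ω}

/-- The closed simplex spanned by the vertices of an element. -/
def Elem.carrier (T : 𝒯.Elem) : Set (Euc d) := convexHull ℝ (T.1 : Set (Euc d))

/-- `S` is (the vertex set of) a side, i.e. a `(d - 1)`-dimensional face, of the element `T`. -/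
def Elem.IsSide (T : 𝒯.Elem) (S : Finset (Euc d)) : Prop := S ⊆ T.1 ∧ S.card = d

/-- `n` is the outward unit normal of the element `T` on its side `S`. -/
def Elem.IsOutwardNormal (T : 𝒯.Elem) (S : Finset (Euc d)) (n : Euc d) : Prop :=
  ‖n‖ = 1 ∧ (∀ x ∈ S, ∀ y ∈ S, inner ℝ (y - x) n = 0) ∧
    ∀ x ∈ S, ∀ p ∈ T.1, p ∉ S → inner ℝ (p - x) n < 0

/-- `S` is a boundary side: it is a side of the element `T` and of no other element. -/
def Elem.IsBoundarySide (T : 𝒯.Elem) (S : Finset (Euc d)) : Prop :=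
  T.IsSide S ∧ ∀ T' : 𝒯.Elem, T'.IsSide S → T' = T

/-- The barycenter `x_S` of a side. -/
noncomputable def sideBarycenter (S : Finset (Euc d)) : Euc d := (d : ℝ)⁻¹ • ∑ z ∈ S, z

variable (𝒯) (F : Type*) [AddCommGroup F] [Module ℝ F]

/-- `𝓛⁰(𝒯)^l`: element-wise constant functions, given by their values on the elements. -/
abbrev L0 := 𝒯.Elem → F

/-- `𝓛¹(𝒯)^l`: element-wise affine functions (no continuity between elements), given by the affine
maps which represent them on the elements. -/
abbrev L1 := 𝒯.Elem → (Euc d →ᵃ[ℝ] F)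

variable {𝒯} {F}

/-- The function on `Ω` which is equal to `v T` in the interior of each element `T` (and `0` on the
null set of points in no such interior). -/
noncomputable def glue (v : 𝒯.Elem → Euc d → F) : Euc d → F :=
  fun x => ∑ T : 𝒯.Elem, (interior T.carrier).indicator (v T) x

/-- The function on `Ω` belonging to an element of `𝓛⁰(𝒯)^l`. -/
noncomputable def L0.toFun (c : L0 𝒯 F) : Euc d → F := glue (fun T _ => c T)

/-- The function on `Ω` belonging to an element of `𝓛¹(𝒯)^l`. -/
noncomputable def L1.toFun (v : L1 𝒯 F) : Euc d → F := glue (fun T => ⇑(v T))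

variable (𝒯) in
/-- The local `L²`-projection `Π_h` onto element-wise constants: the mean value on each element. -/
noncomputable def proj {F : Type*} [NormedAddCommGroup F] [NormedSpace ℝ F] (v : Euc d → F) :
    L0 𝒯 F :=
  fun T => ⨍ x in T.carrier, v x

/-- The element-wise gradient `∇_h`: the vector representing the linear part on each element. -/
noncomputable def grad (v : L1 𝒯 ℝ) : L0 𝒯 (Euc d) :=
  fun T => (InnerProductSpace.toDual ℝ (Euc d)).symm (LinearMap.toContinuousLinearMap (v T).linear)

/-- The element-wise divergence: the trace of the linear part on each element. On Raviart-Thomas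
fields, which have no normal jumps, it is the (distributional) divergence on `Ω`. -/
noncomputable def div (y : L1 𝒯 (Euc d)) : L0 𝒯 ℝ :=
  fun T => LinearMap.trace ℝ (Euc d) (y T).linear

variable (𝒯)

/-- The Crouzeix-Raviart space `𝓢^{1,cr}(𝒯)`: element-wise affine functions which are continuous at
the barycenters of the interior sides. (If two different elements share a side, it is interior.) -/
def CR : Set (L1 𝒯 ℝ) :=
  {v | ∀ (S : Finset (Euc d)) (T T' : 𝒯.Elem), T.IsSide S → T'.IsSide S →
    v T (sideBarycenter S) = v T' (sideBarycenter S)}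

/-- The Raviart-Thomas space with vanishing normal component on the whole boundary:
element-wise affine vector fields whose normal component is constant on each side of each element,
has no jump across interior sides, and is zero on boundary sides. -/
def RTN : Set (L1 𝒯 (Euc d)) :=
  {y | (∀ (T : 𝒯.Elem) (S : Finset (Euc d)) (n : Euc d), T.IsSide S → T.IsOutwardNormal S n →
        ∃ c : ℝ, ∀ x ∈ convexHull ℝ (S : Set (Euc d)), inner ℝ (y T x) n = c) ∧
    (∀ (T T' : 𝒯.Elem) (S : Finset (Euc d)) (n n' : Euc d), T ≠ T' → T.IsSide S → T'.IsSide S →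
        T.IsOutwardNormal S n → T'.IsOutwardNormal S n' →
        ∀ x ∈ convexHull ℝ (S : Set (Euc d)), inner ℝ (y T x) n + inner ℝ (y T' x) n' = 0) ∧
    (∀ (T : 𝒯.Elem) (S : Finset (Euc d)) (n : Euc d), T.IsBoundarySide S →
        T.IsOutwardNormal S n → ∀ x ∈ convexHull ℝ (S : Set (Euc d)), inner ℝ (y T x) n = 0)}

/-- The discrete primal energy
`I_h(v) = ‖∇_h v‖_{L¹(Ω)} + (α/2) ‖Π_h v - g_h‖²_{L²(Ω)}` with `g_h = Π_h g`. -/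
noncomputable def primal (α : ℝ) (g : Euc d → ℝ) (v : L1 𝒯 ℝ) : ℝ :=
  (∫ x in Ω, ‖(grad v).toFun x‖) +
    α / 2 * ∫ x in Ω, ((𝒯.proj v.toFun).toFun x - (𝒯.proj g).toFun x) ^ 2

end Triangulation

open Classical in
/-- The indicator functional of `{y : |y| ≤ 1 a.e. in Ω}`. -/
noncomputable def unitBallIndicator {d : ℕ} (Ω : Set (Euc d)) (y : Euc d → Euc d) : EReal :=
  if ∀ᵐ x ∂(volume.restrict Ω), ‖y x‖ ≤ 1 then 0 else ⊤

/-- The regularized modulus `f_ε(t) = (1 - ε) (t² + ε²)^{1/2}`. -/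
noncomputable def fReg (ε t : ℝ) : ℝ := (1 - ε) * √(t ^ 2 + ε ^ 2)

namespace Triangulation

variable {d : ℕ} {Ω : Set (Euc d)} (𝒯 : Triangulation Ω)

/-- The discrete dual energy
`D_h(y) = - I_{K_1(0)}(Π_h y) - 1/(2α) ‖div y + α g_h‖²_{L²(Ω)} + (α/2) ‖g_h‖²_{L²(Ω)}`. -/
noncomputable def dual (α : ℝ) (g : Euc d → ℝ) (y : L1 𝒯 (Euc d)) : EReal :=
  -unitBallIndicator Ω (𝒯.proj y.toFun).toFun +
    ((-(1 / (2 * α)) * (∫ x in Ω, ((div y).toFun x + α * (𝒯.proj g).toFun x) ^ 2) +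
      α / 2 * ∫ x in Ω, ((𝒯.proj g).toFun x) ^ 2 : ℝ) : EReal)

/-- The regularized discrete primal energy
`I_{h,ε}(v) = ‖f_ε(|∇_h v|)‖_{L¹(Ω)} + (α/2) ‖Π_h v - g_h‖²_{L²(Ω)}`. -/
noncomputable def primalReg (α : ℝ) (g : Euc d → ℝ) (ε : L0 𝒯 ℝ) (v : L1 𝒯 ℝ) : ℝ :=
  (∫ x in Ω, |fReg (ε.toFun x) ‖(grad v).toFun x‖|) +
    α / 2 * ∫ x in Ω, ((𝒯.proj v.toFun).toFun x - (𝒯.proj g).toFun x) ^ 2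

/-- The Marini reconstruction of a flux from `u`: on each element `T` it is the affine vector field
`f_ε'(|∇u|)/|∇u| ∇u + α (Π_h u - g_h)/d (id - Π_h id)`. Where `∇u = 0`, the first term is `0`. -/
noncomputable def marini (α : ℝ) (g : Euc d → ℝ) (ε : L0 𝒯 ℝ) (u : L1 𝒯 ℝ) : L1 𝒯 (Euc d) :=
  fun T =>
    AffineMap.const ℝ (Euc d) ((deriv (fReg (ε T)) ‖grad u T‖ / ‖grad u T‖) • grad u T) +
      (α * ((𝒯.proj u.toFun T - 𝒯.proj g T) / d)) •
        (AffineMap.id ℝ (Euc d) - AffineMap.const ℝ (Euc d) (𝒯.proj (fun x => x) T))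

end Triangulation

end ROF

open ROF

/-!
The proof is finite-dimensional convex duality. An element-wise affine function `v` is determined by
its element-wise gradients and mean values (`gradMean`), and both energies are functions of these
coordinates: `energy` and `energyReg`, weighted sums over the elements. Coercivity gives minimizers,
strict midpoint convexity of `f_ε` and of the quadratic term gives uniqueness, and differentiation
gives the Euler-Lagrange equation (`eulerLagrange`).

The link with the Raviart-Thomas space is `rtField_mem_RTN_iff`. A field in this space is, on each
element `T`, of the form `a T + c T • (id - center T)`, because the constancy of its normal
components forces its linear part to be a multiple of the identity. Such a field has no normal jumps
and no normal component on the boundary if and only if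
`∑ |T| (a · ∇v + d c Π_h v) = 0` for all Crouzeix-Raviart functions `v`. To see this, test with the
basis function `1 - d λ` of a side, where `λ` is the barycentric coordinate of the opposite vertex:
the sum becomes the sum of the fluxes through this side, weighted by `|T| |∇λ|`, and this weight
takes the same value on the two elements which share the side. The geometric facts behind this are
obtained from shears, i.e. rank one perturbations of the identity: exchanging two vertices of a
simplex preserves the volume, so that mean values of affine maps are values at the barycenter;
moving the vertex opposite to a side compares the volumes of neighbouring elements. Conformity of
the triangulation shows that neighbouring elements lie on different sides of their common side, and
hence that a side belongs to at most two elements.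

The Marini reconstructions are exactly the fields `rtField` whose orthogonality to the
Crouzeix-Raviart space is the Euler-Lagrange equation, so they lie in the Raviart-Thomas space. As
the parameters tend to zero, minimizers and fluxes stay bounded, and along a subsequence they
converge to some `u` and `p` with `|p| ≤ 1` and `p · ∇u = |∇u|`, while the orthogonality persists
(`exists_subseq_tendsto`). The duality gap is a sum of nonnegative terms which vanish if and only if
the optimality relations hold (`energy_eq_dualEnergy_iff`); since it vanishes for the limits, `u` is
a minimizer, the limit field is a maximizer, and the optimality relations hold for every minimizer.
-/

/-! ### Affine maps and shears -/

namespace ROF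

variable {d : ℕ}

theorem affineMap_smul_sum {F : Type*} [AddCommGroup F] [Module ℝ F] (v : Euc d →ᵃ[ℝ] F)
    (s : Finset (Euc d)) {c : ℝ} (hc : c * s.card = 1) :
    v (c • ∑ z ∈ s, z) = c • ∑ z ∈ s, v z := by
  have h : ∀ x, v x = v.linear x + v 0 := fun x => congrFun v.decomp x
  rw [h, Finset.sum_congr rfl fun z _ => h z, Finset.sum_add_distrib, Finset.sum_const, map_smul,
    map_sum, smul_add, ← Nat.cast_smul_eq_nsmul ℝ, smul_smul, hc, one_smul]

theorem hasFDerivAt_affineMap (A : Euc d →ᵃ[ℝ] Euc d) (x : Euc d) :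
    HasFDerivAt A (LinearMap.toContinuousLinearMap A.linear) x := by
  have h : (A : Euc d → Euc d) = fun y => LinearMap.toContinuousLinearMap A.linear y + A 0 :=
    A.decomp
  rw [h]
  exact (ContinuousLinearMap.hasFDerivAt _).add_const _

/-- Change of variables under an invertible affine map. -/
theorem setIntegral_image_affineMap {F : Type*} [NormedAddCommGroup F] [NormedSpace ℝ F]
    (A : Euc d →ᵃ[ℝ] Euc d) (hA : LinearMap.det A.linear ≠ 0) {s : Set (Euc d)}
    (hs : MeasurableSet s) (f : Euc d → F) :
    ∫ x in A '' s, f x = |LinearMap.det A.linear| • ∫ x in s, f (A x) := by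
  have hinj : Function.Injective A := by
    rw [← AffineMap.linear_injective_iff]
    exact (LinearMap.equivOfDetNeZero _ hA).injective
  rw [integral_image_eq_integral_abs_det_fderiv_smul volume hs
    (fun x _ => (hasFDerivAt_affineMap A x).hasFDerivWithinAt) hinj.injOn f, integral_smul]
  simp [ContinuousLinearMap.det]

/-- The affine map `x ↦ x + ℓ x • w`. -/
noncomputable def shear (ℓ : Euc d →ᵃ[ℝ] ℝ) (w : Euc d) : Euc d →ᵃ[ℝ] Euc d where
  toFun x := x + ℓ x • w
  linear := LinearMap.transvection ℓ.linear w
  map_vadd' p v := by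
    rw [AffineMap.map_vadd, LinearMap.transvection.apply, vadd_eq_add, vadd_eq_add, vadd_eq_add,
      add_smul]
    abel

theorem shear_apply (ℓ : Euc d →ᵃ[ℝ] ℝ) (w x : Euc d) : shear ℓ w x = x + ℓ x • w := rfl

theorem det_shear (ℓ : Euc d →ᵃ[ℝ] ℝ) (w : Euc d) :
    LinearMap.det (shear ℓ w).linear = 1 + ℓ.linear w :=
  LinearMap.transvection.det _ _

namespace Triangulation

variable {Ω : Set (Euc d)} {𝒯 : Triangulation Ω}

/-! ### A single element -/

namespace Elem

variable (T : 𝒯.Elem)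

theorem affineSpan_eq_top : affineSpan ℝ (T.1 : Set (Euc d)) = ⊤ := by
  have h := (𝒯.complex.indep T.2.1).affineSpan_eq_top_iff_card_eq_finrank_add_one.2
    (by simp [T.2.2])
  simpa using h

/-- The vertices of an element as an affine basis; its coordinates are the barycentric
coordinates. -/
noncomputable def basis : AffineBasis T.1 ℝ (Euc d) where
  toFun := Subtype.val
  ind' := 𝒯.complex.indep T.2.1
  tot' := by simpa using T.affineSpan_eq_top

theorem basis_apply (p : T.1) : T.basis p = p := rfl

theorem range_basis : Set.range T.basis = (T.1 : Set (Euc d)) := by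
  change Set.range Subtype.val = _
  simp

variable {T} in
theorem affineMap_ext {F : Type*} [AddCommGroup F] [Module ℝ F] {v w : Euc d →ᵃ[ℝ] F}
    (h : ∀ p ∈ T.1, v p = w p) : v = w :=
  AffineMap.ext_on T.affineSpan_eq_top fun p hp => h p hp

theorem mem_carrier_iff {x : Euc d} : x ∈ T.carrier ↔ ∀ p, 0 ≤ T.basis.coord p x := by
  rw [carrier, ← range_basis, AffineBasis.convexHull_eq_nonneg_coord]; rfl

theorem mem_interior_iff {x : Euc d} : x ∈ interior T.carrier ↔ ∀ p, 0 < T.basis.coord p x := by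
  rw [carrier, ← range_basis, AffineBasis.interior_convexHull]; rfl

theorem convex_carrier : Convex ℝ T.carrier := convex_convexHull ℝ _

theorem isCompact_carrier : IsCompact T.carrier := T.1.finite_toSet.isCompact_convexHull ℝ

theorem interior_nonempty : (interior T.carrier).Nonempty :=
  interior_convexHull_nonempty_iff_affineSpan_eq_top.2 T.affineSpan_eq_top

theorem interior_ae_eq : interior T.carrier =ᵐ[volume] T.carrier :=
  interior_ae_eq_of_null_frontier (T.convex_carrier.addHaar_frontier volume)

/-- The volume `|T|` of an element. -/
noncomputable def vol : ℝ := volume.real T.carrier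

theorem vol_pos : 0 < T.vol :=
  ENNReal.toReal_pos
    (ne_of_gt <| (isOpen_interior.measure_pos volume T.interior_nonempty).trans_le
      (measure_mono interior_subset)) T.isCompact_carrier.measure_lt_top.ne

/-- The barycenter of an element. -/
noncomputable def center : Euc d := ((d : ℝ) + 1)⁻¹ • ∑ z ∈ T.1, z

theorem apply_center {F : Type*} [AddCommGroup F] [Module ℝ F] (v : Euc d →ᵃ[ℝ] F) :
    v T.center = ((d : ℝ) + 1)⁻¹ • ∑ z ∈ T.1, v z :=
  affineMap_smul_sum v T.1 (by rw [T.2.2]; push_cast; field_simp)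

theorem coord_apply_center (p : T.1) : T.basis.coord p T.center = ((d : ℝ) + 1)⁻¹ := by
  classical
  rw [apply_center, ← Finset.sum_coe_sort T.1]
  simp_rw [← T.basis_apply, AffineBasis.coord_apply]
  simp

theorem continuous_coord (p : T.1) : Continuous (T.basis.coord p) :=
  AffineMap.continuous_of_finiteDimensional _

theorem integrableOn_affineMap {F : Type*} [NormedAddCommGroup F] [NormedSpace ℝ F]
    (v : Euc d →ᵃ[ℝ] F) : IntegrableOn v T.carrier :=
  v.continuous_of_finiteDimensional.continuousOn.integrableOn_compact T.isCompact_carrier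

theorem integral_coord_eq (p q : T.1) :
    ∫ x in T.carrier, T.basis.coord p x = ∫ x in T.carrier, T.basis.coord q x := by
  classical
  rcases eq_or_ne p q with rfl | hpq
  · rfl
  -- the affine map which exchanges the vertices `p` and `q`
  let A := shear (T.basis.coord p - T.basis.coord q) ((q : Euc d) - p)
  have hlin : (T.basis.coord p - T.basis.coord q).linear ((q : Euc d) - p) = -2 := by
    have h := (T.basis.coord p - T.basis.coord q).linearMap_vsub (q : Euc d) p
    rw [vsub_eq_sub, vsub_eq_sub] at h
    rw [h, ← T.basis_apply, ← T.basis_apply]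
    simp [hpq, hpq.symm]
    norm_num
  have hdet : LinearMap.det A.linear = -1 := by
    rw [det_shear, hlin]; norm_num
  have hcoord : ∀ r : T.1,
      A r = if r = p then (q : Euc d) else if r = q then (p : Euc d) else r := by
    intro r
    change (r : Euc d) + (T.basis.coord p - T.basis.coord q) (T.basis r) • ((q : Euc d) - p) = _
    by_cases h1 : r = p
    · subst h1; simp [hpq.symm]
    · by_cases h2 : r = q
      · subst h2; simp [h1, Ne.symm h1]
      · simp [h1, h2, Ne.symm h1, Ne.symm h2]
  have himg : A '' T.carrier = T.carrier := by
    rw [carrier, AffineMap.image_convexHull]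
    congr 1
    ext x
    constructor
    · rintro ⟨r, hr, rfl⟩
      rw [hcoord ⟨r, hr⟩]
      split_ifs
      exacts [q.2, p.2, hr]
    · intro hx
      by_cases h1 : x = p
      · exact ⟨q, q.2, by rw [hcoord, if_neg hpq.symm, if_pos rfl, h1]⟩
      · by_cases h2 : x = q
        · exact ⟨p, p.2, by rw [hcoord, if_pos rfl, h2]⟩
        · refine ⟨x, hx, ?_⟩
          rw [hcoord ⟨x, hx⟩, if_neg (fun h => h1 (congrArg Subtype.val h)),
            if_neg (fun h => h2 (congrArg Subtype.val h))]
  have hcomp : (T.basis.coord p).comp A = T.basis.coord q := by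
    refine affineMap_ext (T := T) fun r hr => ?_
    rw [AffineMap.comp_apply, hcoord ⟨r, hr⟩]
    have hb : r = T.basis ⟨r, hr⟩ := rfl
    split_ifs with h1 h2
    · rw [hb, h1, ← T.basis_apply q]; simp [hpq, hpq.symm]
    · rw [hb, h2, ← T.basis_apply p]; simp
    · change T.basis.coord p (T.basis ⟨r, hr⟩) = T.basis.coord q (T.basis ⟨r, hr⟩)
      simp [Ne.symm h1, Ne.symm h2]
  calc ∫ x in T.carrier, T.basis.coord p x = ∫ x in A '' T.carrier, T.basis.coord p x := by
        rw [himg]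
    _ = ∫ x in T.carrier, T.basis.coord p (A x) := by
        rw [setIntegral_image_affineMap A (by rw [hdet]; norm_num)
          T.isCompact_carrier.measurableSet, hdet]
        simp
    _ = _ := by simp_rw [← AffineMap.comp_apply, hcomp]

theorem setAverage_coord (p : T.1) : ⨍ x in T.carrier, T.basis.coord p x = ((d : ℝ) + 1)⁻¹ := by
  have hsum : ∑ q, ∫ x in T.carrier, T.basis.coord q x = T.vol := by
    rw [← integral_finsetSum _ fun q _ => T.integrableOn_affineMap _]
    simp_rw [AffineBasis.sum_coord_apply_eq_one]
    simp [vol]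
  simp_rw [T.integral_coord_eq _ p] at hsum
  rw [Finset.sum_const, Finset.card_univ, Fintype.card_coe, T.2.2, nsmul_eq_mul] at hsum
  rw [setAverage_eq]
  change T.vol⁻¹ • _ = _
  have := T.vol_pos
  rw [smul_eq_mul]
  push_cast at hsum
  field_simp
  linarith

/-- Affine maps commute with averages over a simplex. -/
theorem setAverage_affineMap_eq_apply_average {F : Type*} [NormedAddCommGroup F] [NormedSpace ℝ F]
    [CompleteSpace F] (v : Euc d →ᵃ[ℝ] F) :
    ⨍ x in T.carrier, v x = v (⨍ x in T.carrier, x) := by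
  have h : ∀ x, v x = LinearMap.toContinuousLinearMap v.linear x + v 0 :=
    fun x => congrFun v.decomp x
  have hid : IntegrableOn (fun x : Euc d => x) T.carrier :=
    T.integrableOn_affineMap (AffineMap.id ℝ _)
  have hc : IntegrableOn (fun _ : Euc d => v 0) T.carrier :=
    T.integrableOn_affineMap (AffineMap.const ℝ _ (v 0))
  have hL : IntegrableOn (fun x => LinearMap.toContinuousLinearMap v.linear x) T.carrier :=
    ContinuousLinearMap.integrable_comp _ hid
  rw [setAverage_eq, setAverage_eq, h, integral_congr_ae (Eventually.of_forall h),
    integral_add hL hc, ContinuousLinearMap.integral_comp_comm _ hid, setIntegral_const, map_smul,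
    smul_add, smul_smul]
  change _ + (T.vol⁻¹ * T.vol) • _ = _
  rw [inv_mul_cancel₀ T.vol_pos.ne', one_smul]

theorem setAverage_id : ⨍ x in T.carrier, x = T.center :=
  T.basis.ext_elem fun p => by
    rw [← setAverage_affineMap_eq_apply_average, setAverage_coord, coord_apply_center]

/-- The mean value of an affine map on a simplex is its value at the barycenter. -/
theorem setAverage_affineMap {F : Type*} [NormedAddCommGroup F] [NormedSpace ℝ F]
    [CompleteSpace F] (v : Euc d →ᵃ[ℝ] F) : ⨍ x in T.carrier, v x = v T.center := by
  rw [setAverage_affineMap_eq_apply_average, setAverage_id]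

end Elem

end Triangulation

end ROF

namespace ROF

variable {d : ℕ}

/-- Evaluation of affine maps at a point, as an additive map. -/
noncomputable def affineEval {F : Type*} [AddCommGroup F] [Module ℝ F] (x : Euc d) :
    (Euc d →ᵃ[ℝ] F) →+ F where
  toFun v := v x
  map_zero' := rfl
  map_add' _ _ := rfl

theorem affineMap_sum_apply {F ι : Type*} [AddCommGroup F] [Module ℝ F] (s : Finset ι)
    (f : ι → Euc d →ᵃ[ℝ] F) (x : Euc d) : (∑ i ∈ s, f i) x = ∑ i ∈ s, f i x :=
  map_sum (affineEval x) f s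

/-- An affine map vanishing on a set vanishes on its convex hull. -/
theorem affineMap_eq_zero_of_mem_convexHull {v : Euc d →ᵃ[ℝ] ℝ} {s : Set (Euc d)}
    (h : ∀ q ∈ s, v q = 0) {x : Euc d} (hx : x ∈ convexHull ℝ s) : v x = 0 :=
  convexHull_min (t := v ⁻¹' {0}) (fun q hq => h q hq) ((convex_singleton 0).affine_preimage v) hx

/-- The gradient of an affine function, as a linear function of it. -/
noncomputable def affineGrad : (Euc d →ᵃ[ℝ] ℝ) →ₗ[ℝ] Euc d where
  toFun v := (InnerProductSpace.toDual ℝ (Euc d)).symm (LinearMap.toContinuousLinearMap v.linear)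
  map_add' v w := by simp
  map_smul' c v := by simp

theorem inner_affineGrad (v : Euc d →ᵃ[ℝ] ℝ) (w : Euc d) :
    inner ℝ w (affineGrad v) = v.linear w := by
  rw [real_inner_comm]
  simp [affineGrad]

theorem inner_sub_affineGrad (v : Euc d →ᵃ[ℝ] ℝ) (x y : Euc d) :
    inner ℝ (x - y) (affineGrad v) = v x - v y := by
  rw [inner_affineGrad]
  exact v.linearMap_vsub x y

namespace Triangulation

variable {Ω : Set (Euc d)} {𝒯 : Triangulation Ω}

theorem apply_sideBarycenter (hd : 1 ≤ d) {F : Type*} [AddCommGroup F] [Module ℝ F]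
    (v : Euc d →ᵃ[ℝ] F) {S : Finset (Euc d)} (hS : S.card = d) :
    v (sideBarycenter S) = (d : ℝ)⁻¹ • ∑ z ∈ S, v z :=
  affineMap_smul_sum v S (by rw [hS]; exact inv_mul_cancel₀ (by positivity))

theorem sideBarycenter_mem (hd : 1 ≤ d) {S : Finset (Euc d)} (hS : S.card = d) :
    sideBarycenter S ∈ convexHull ℝ (S : Set (Euc d)) := by
  rw [sideBarycenter, Finset.smul_sum]
  refine (convex_convexHull ℝ _).sum_mem (fun _ _ => by positivity) ?_
    (fun z hz => subset_convexHull ℝ _ hz)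
  rw [Finset.sum_const, hS, nsmul_eq_mul]
  exact mul_inv_cancel₀ (by positivity)

namespace Elem

variable {T T' : 𝒯.Elem} {S : Finset (Euc d)}

theorem IsSide.exists_insert [DecidableEq (Euc d)] (h : T.IsSide S) :
    ∃ p, p ∉ S ∧ T.1 = insert p S := by
  obtain ⟨p, hp, hT⟩ := Finset.exists_eq_insert_iff.2 ⟨h.1, by rw [h.2, T.2.2]⟩
  exact ⟨p, hp, hT.symm⟩

/-- By conformity, the common points of two elements lie on a proper face of each of them. -/
theorem disjoint_interior (h : T ≠ T') : Disjoint (interior T.carrier) T'.carrier := by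
  rw [Set.disjoint_left]
  intro x hx hx'
  have hmem := 𝒯.complex.inter_subset_convexHull T.2.1 T'.2.1 ⟨interior_subset hx, hx'⟩
  obtain ⟨p, hp, hp'⟩ : ∃ p ∈ T.1, p ∉ T'.1 := by
    by_contra! hsub
    exact h (Subtype.ext (Finset.eq_of_subset_of_card_le hsub (by rw [T.2.2, T'.2.2])))
  have h0 := (T.mem_interior_iff.1 hx ⟨p, hp⟩).ne'
  refine h0 (affineMap_eq_zero_of_mem_convexHull ?_ hmem)
  rintro q ⟨hq, hq'⟩
  change T.basis.coord ⟨p, hp⟩ (T.basis ⟨q, hq⟩) = 0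
  refine T.basis.coord_apply_ne fun hpq => hp' ?_
  have h' : p = q := congrArg Subtype.val hpq
  exact h' ▸ hq'

/-! ### Heights over a side -/

open Classical in
/-- The affine function on the element `T` which vanishes at the vertices in `S` and is `1` at the
others. If `S` is a side, it is the barycentric coordinate of the vertex opposite to `S`. -/
noncomputable def height (T : 𝒯.Elem) (S : Finset (Euc d)) : Euc d →ᵃ[ℝ] ℝ :=
  ∑ p : T.1, if (p : Euc d) ∈ S then 0 else T.basis.coord p

open Classical in
theorem height_vertex {q : Euc d} (hq : q ∈ T.1) :
    T.height S q = if q ∈ S then 0 else 1 := by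
  rw [height, affineMap_sum_apply]
  have h : ∀ p : T.1, (if (p : Euc d) ∈ S then 0 else T.basis.coord p) q =
      if p = ⟨q, hq⟩ then (if q ∈ S then 0 else 1) else 0 := by
    intro p
    have hb : T.basis.coord p q = if p = ⟨q, hq⟩ then 1 else 0 :=
      T.basis.coord_apply p ⟨q, hq⟩
    by_cases hp : p = ⟨q, hq⟩
    · rw [if_pos hp] at hb ⊢
      have : (p : Euc d) = q := congrArg Subtype.val hp
      rw [this]
      split_ifs with h1
      · rfl
      · exact hb
    · rw [if_neg hp] at hb ⊢
      split_ifs with h1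
      · rfl
      · exact hb
  rw [Finset.sum_congr rfl fun p _ => h p]
  simp

theorem height_eq_zero_of_mem (hS : T.IsSide S) {x : Euc d}
    (hx : x ∈ convexHull ℝ (S : Set (Euc d))) : T.height S x = 0 := by
  classical
  exact affineMap_eq_zero_of_mem_convexHull
    (fun q hq => by rw [height_vertex (hS.1 hq), if_pos (Finset.mem_coe.1 hq)]) hx

theorem height_center (hS : T.IsSide S) : T.height S T.center = ((d : ℝ) + 1)⁻¹ := by
  classical
  obtain ⟨p, hp, hT⟩ := hS.exists_insert
  rw [apply_center, Finset.sum_congr rfl fun q hq => height_vertex hq, hT,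
    Finset.sum_insert hp, if_neg hp, Finset.sum_eq_zero fun q hq => if_pos hq]
  simp

/-- An affine function which vanishes on a side is a multiple of the height over it. -/
theorem eq_smul_height [DecidableEq (Euc d)] {v : Euc d →ᵃ[ℝ] ℝ} {p : Euc d} (hp : p ∉ S)
    (hT : T.1 = insert p S) (hv : ∀ q ∈ S, v q = 0) : v = v p • T.height S := by
  classical
  refine affineMap_ext (T := T) fun q hq => ?_
  rw [AffineMap.coe_smul, Pi.smul_apply, height_vertex hq]
  rw [hT, Finset.mem_insert] at hq
  rcases hq with rfl | hq
  · simp [hp]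
  · simp [hq, hv q hq]

/-- Two elements with a common side lie on different sides of it; otherwise, by conformity, points
which are close to the barycenter of the side would lie on the side itself. -/
theorem height_opposite_neg [DecidableEq (Euc d)] (hd : 1 ≤ d) (hne : T ≠ T') (hS : T.IsSide S)
    {p' : Euc d} (hp' : p' ∉ S) (hT' : T'.1 = insert p' S) : T.height S p' < 0 := by
  classical
  obtain ⟨p, hp, hT⟩ := hS.exists_insert
  by_contra! hnn
  have hside : T'.IsSide S := ⟨by rw [hT']; exact Finset.subset_insert _ _, hS.2⟩
  have hxS := sideBarycenter_mem hd hS.2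
  -- points on the segment from the barycenter of `S` to `p'` close to `S` are in both elements
  let γ : ℝ → Euc d := fun t => AffineMap.lineMap (sideBarycenter S) p' t
  have hγ : Continuous γ := AffineMap.lineMap_continuous
  have hγ0 : γ 0 = sideBarycenter S := AffineMap.lineMap_apply_zero _ _
  have hev : ∀ᶠ t in 𝓝[>] (0 : ℝ), ∀ q : T.1, (q : Euc d) ∈ S → 0 < T.basis.coord q (γ t) := by
    refine eventually_all.2 fun q => ?_
    by_cases hq : (q : Euc d) ∈ S
    · have h1 : 0 < T.basis.coord q (γ 0) := by
        rw [hγ0, apply_sideBarycenter hd _ hS.2, Finset.sum_eq_single_of_mem (q : Euc d) hq]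
        · rw [← T.basis_apply, AffineBasis.coord_apply_eq, smul_eq_mul, mul_one]
          positivity
        · intro r hr hrq
          exact T.basis.coord_apply_ne (i := q) (j := ⟨r, hS.1 hr⟩)
            fun h => hrq (congrArg Subtype.val h).symm
      have h2 := ((T.continuous_coord q).comp hγ).continuousAt.eventually (lt_mem_nhds h1)
      filter_upwards [nhdsWithin_le_nhds h2] with t ht _ using ht
    · exact Eventually.of_forall fun t h => absurd h hq
  obtain ⟨t, ht, ht0, ht1⟩ := (hev.and (Ioc_mem_nhdsGT one_pos)).exists
  have hmul : ∀ v : Euc d →ᵃ[ℝ] ℝ, v (sideBarycenter S) = 0 → v (γ t) = t * v p' := by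
    intro v hv
    simp only [γ]
    rw [AffineMap.apply_lineMap, hv, AffineMap.lineMap_apply]
    simp
  have hmemT : γ t ∈ T.carrier := by
    rw [mem_carrier_iff]
    intro q
    by_cases hq : (q : Euc d) ∈ S
    · exact (ht q hq).le
    · have hqp : (q : Euc d) = p := by
        have hm : ∀ r ∈ T.1, r ∉ S → r = p := fun r hr h =>
          (Finset.mem_insert.1 (hT ▸ hr)).resolve_right h
        exact hm q q.2 hq
      have hcoord : T.basis.coord q = T.height S := by
        refine affineMap_ext (T := T) fun r hr => ?_
        rw [height_vertex hr]
        change T.basis.coord q (T.basis ⟨r, hr⟩) = _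
        rw [AffineBasis.coord_apply]
        have : q = ⟨r, hr⟩ ↔ r ∉ S := by
          rw [hT, Finset.mem_insert] at hr
          rw [Subtype.ext_iff, hqp]
          constructor
          · rintro rfl; exact hp
          · intro h; exact (hr.resolve_right h).symm
        simp only [this]
        split_ifs <;> simp_all
      rw [hcoord, hmul _ (height_eq_zero_of_mem hS hxS)]
      exact mul_nonneg ht0.le hnn
  have hmemT' : γ t ∈ T'.carrier := by
    refine T'.convex_carrier.lineMap_mem ?_ ?_ ⟨ht0.le, ht1⟩
    · exact convexHull_mono (by exact_mod_cast hside.1) hxS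
    · exact subset_convexHull ℝ _ (by rw [hT']; simp)
  have hsub : ((T.1 : Set (Euc d)) ∩ T'.1) ⊆ S := by
    rintro x ⟨hx, hx'⟩
    rw [Finset.mem_coe, hT, Finset.mem_insert] at hx
    rw [Finset.mem_coe, hT', Finset.mem_insert] at hx'
    rcases hx with rfl | hx
    · rcases hx' with rfl | hx'
      · exact absurd (Subtype.ext (hT.trans hT'.symm)) hne
      · exact hx'
    · exact hx
  have hconv := convexHull_mono hsub
    (𝒯.complex.inter_subset_convexHull T.2.1 T'.2.1 ⟨hmemT, hmemT'⟩)
  have h0 := height_eq_zero_of_mem hside hconv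
  rw [hmul _ (height_eq_zero_of_mem hside hxS), height_vertex (by rw [hT']; simp), if_neg hp',
    mul_one] at h0
  exact ht0.ne' h0

/-- The heights of two elements over a common side are proportional. -/
theorem height_eq_smul_height [DecidableEq (Euc d)] (hS : T.IsSide S)
    {p' : Euc d} (hp' : p' ∉ S) (hT' : T'.1 = insert p' S) :
    T.height S = T.height S p' • T'.height S :=
  eq_smul_height hp' hT' fun _ hq => height_eq_zero_of_mem hS (subset_convexHull ℝ _ hq)

/-- The volumes of two elements with a common side are in the ratio of their heights: a shear
which fixes the side maps one onto the other. -/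
theorem vol_eq_mul_vol [DecidableEq (Euc d)] (hd : 1 ≤ d) (hne : T ≠ T') (hS : T.IsSide S)
    {p' : Euc d} (hp' : p' ∉ S) (hT' : T'.1 = insert p' S) :
    T'.vol = -T.height S p' * T.vol := by
  obtain ⟨p, hp, hT⟩ := hS.exists_insert
  have hneg := height_opposite_neg hd hne hS hp' hT'
  have hhp : T.height S p = 1 := by
    rw [height_vertex (by rw [hT]; simp), if_neg hp]
  let A := shear (T.height S) (p' - p)
  have hdet : LinearMap.det A.linear = T.height S p' := by
    rw [det_shear]
    have h := (T.height S).linearMap_vsub p' p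
    rw [vsub_eq_sub, vsub_eq_sub] at h
    rw [h, hhp]; ring
  have hAp : A p = p' := by
    rw [shear_apply, hhp]; simp
  have hAS : ∀ q ∈ S, A q = q := fun q hq => by
    rw [shear_apply, height_eq_zero_of_mem hS (subset_convexHull ℝ _ hq)]; simp
  have himg : A '' T.carrier = T'.carrier := by
    rw [carrier, carrier, AffineMap.image_convexHull, hT, hT', Finset.coe_insert,
      Finset.coe_insert, Set.image_insert_eq, hAp, Set.EqOn.image_eq_self (fun q hq => hAS q hq)]
  have h := setIntegral_image_affineMap A (by rw [hdet]; exact hneg.ne)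
    T.isCompact_carrier.measurableSet (fun _ => (1 : ℝ))
  rw [himg, hdet, abs_of_neg hneg] at h
  simpa [vol] using h

/-- A side belongs to at most two elements. -/
theorem eq_or_eq_of_isSide (hd : 1 ≤ d) {T'' : 𝒯.Elem} (hne : T ≠ T') (hS : T.IsSide S)
    (hS' : T'.IsSide S) (hS'' : T''.IsSide S) : T'' = T ∨ T'' = T' := by
  classical
  by_contra! h
  obtain ⟨p', hp', hT'⟩ := hS'.exists_insert
  obtain ⟨p, hp, hT⟩ := hS''.exists_insert
  have h1 := height_opposite_neg hd hne hS hp' hT'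
  have h2 := height_opposite_neg hd h.1.symm hS hp hT
  have h3 := height_opposite_neg hd h.2.symm hS' hp hT
  have h4 := congrArg (fun v : Euc d →ᵃ[ℝ] ℝ => v p) (height_eq_smul_height hS hp' hT')
  simp only [AffineMap.coe_smul, Pi.smul_apply, smul_eq_mul] at h4
  nlinarith

end Elem

end Triangulation

end ROF

namespace ROF.Triangulation

variable {d : ℕ} {Ω : Set (Euc d)} {𝒯 : Triangulation Ω}

/-! ### Integrals of element-wise defined functions -/

theorem glue_apply {F : Type*} [AddCommGroup F] (v : 𝒯.Elem → Euc d → F) {T : 𝒯.Elem} {x : Euc d}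
    (hx : x ∈ interior T.carrier) : glue v x = v T x := by
  classical
  rw [glue, Finset.sum_eq_single T, Set.indicator_of_mem hx]
  · intro T' _ hne
    refine Set.indicator_of_notMem (fun hx' => ?_) _
    exact Set.disjoint_left.1 (Elem.disjoint_interior hne) hx' (interior_subset hx)
  · simp

theorem interior_subset_domain (hΩ : interior (closure Ω) = Ω) (T : 𝒯.Elem) :
    interior T.carrier ⊆ Ω := by
  have h := interior_mono (𝒯.complex.convexHull_subset_space T.2.1)
  rwa [𝒯.space_eq, hΩ] at h

/-- Up to a null set, `Ω` is covered by the interiors of the elements: the faces of lower dimension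
and the boundaries of the elements are null sets. -/
theorem ae_exists_mem_interior (hΩ : interior (closure Ω) = Ω) :
    ∀ᵐ x ∂(volume.restrict Ω), ∃ T : 𝒯.Elem, x ∈ interior T.carrier := by
  have hface : ∀ s ∈ 𝒯.complex.faces, ∀ᵐ x : Euc d, x ∈ convexHull ℝ (s : Set (Euc d)) →
      ∃ T : 𝒯.Elem, x ∈ interior T.carrier := by
    intro s hs
    by_cases hcard : s.card = d + 1
    · let T : 𝒯.Elem := ⟨s, hs, hcard⟩
      filter_upwards [T.interior_ae_eq.mem_iff] with x hx hxs
      exact ⟨T, hx.2 hxs⟩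
    · have hspan : affineSpan ℝ (s : Set (Euc d)) ≠ ⊤ := by
        intro h
        refine hcard ?_
        have h' := (𝒯.complex.indep hs).affineSpan_eq_top_iff_card_eq_finrank_add_one.1
          (by simpa using h)
        simpa using h'
      have hnull : volume (convexHull ℝ (s : Set (Euc d))) = 0 :=
        measure_mono_null (convexHull_subset_affineSpan _)
          (Measure.addHaar_affineSubspace volume _ hspan)
      filter_upwards [measure_eq_zero_iff_ae_notMem.1 hnull] with x hx hxs
      exact absurd hxs hx
  have hall := (ae_ball_iff 𝒯.finite.countable).2 hface
  have hmeas : MeasurableSet Ω := hΩ ▸ isOpen_interior.measurableSet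
  filter_upwards [ae_restrict_of_ae hall, ae_restrict_mem hmeas] with x hx hxΩ
  have hmem : x ∈ 𝒯.complex.space := 𝒯.space_eq ▸ subset_closure hxΩ
  obtain ⟨s, hs, hxs⟩ := 𝒯.complex.mem_space_iff.1 hmem
  exact hx s hs hxs

theorem ae_of_forall_interior (hΩ : interior (closure Ω) = Ω) {P : Euc d → Prop}
    (h : ∀ T : 𝒯.Elem, ∀ x ∈ interior T.carrier, P x) : ∀ᵐ x ∂(volume.restrict Ω), P x := by
  filter_upwards [ae_exists_mem_interior (𝒯 := 𝒯) hΩ] with x ⟨T, hx⟩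
  exact h T x hx

theorem exists_mem_interior_of_ae (hΩ : interior (closure Ω) = Ω) {P : Euc d → Prop}
    (h : ∀ᵐ x ∂(volume.restrict Ω), P x) (T : 𝒯.Elem) : ∃ x ∈ interior T.carrier, P x := by
  have h' : ∀ᵐ x ∂(volume.restrict (interior T.carrier)), P x :=
    ae_restrict_of_ae_restrict_of_subset (interior_subset_domain hΩ T) h
  have : NeBot (ae (volume.restrict (interior T.carrier))) := by
    rw [ae_restrict_neBot]
    exact (isOpen_interior.measure_pos volume T.interior_nonempty).ne'
  exact ((ae_restrict_mem isOpen_interior.measurableSet).and h').exists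

/-- The integral over `Ω` of an element-wise constant function. -/
theorem setIntegral_eq_sum (hΩ : interior (closure Ω) = Ω) {f : Euc d → ℝ} {c : 𝒯.Elem → ℝ}
    (h : ∀ T, ∀ x ∈ interior T.carrier, f x = c T) : ∫ x in Ω, f x = ∑ T, T.vol * c T := by
  have hΩ' : (⋃ T : 𝒯.Elem, interior T.carrier) =ᵐ[volume] Ω := by
    refine (Set.iUnion_subset fun T => interior_subset_domain hΩ T).eventuallyLE.antisymm ?_
    have hmeas : MeasurableSet Ω := hΩ ▸ isOpen_interior.measurableSet
    filter_upwards [(ae_restrict_iff' hmeas).1 (ae_exists_mem_interior (𝒯 := 𝒯) hΩ)] with x hx hxΩ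
    exact Set.mem_iUnion.2 (hx hxΩ)
  rw [← setIntegral_congr_set hΩ', integral_iUnion_fintype
    (fun T => isOpen_interior.measurableSet)
    (fun T T' hne => (Elem.disjoint_interior hne).mono_right interior_subset)]
  · refine Finset.sum_congr rfl fun T _ => ?_
    rw [setIntegral_congr_fun isOpen_interior.measurableSet (h T), setIntegral_const,
      measureReal_congr T.interior_ae_eq, smul_eq_mul, Elem.vol]
  · intro T
    refine (integrableOn_const (C := c T) ?_).congr_fun (fun x hx => (h T x hx).symm)
      isOpen_interior.measurableSet
    exact ((measure_mono interior_subset).trans_lt T.isCompact_carrier.measure_lt_top).ne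

theorem toFun_L0_apply {F : Type*} [AddCommGroup F] [Module ℝ F] (c : L0 𝒯 F) {T : 𝒯.Elem}
    {x : Euc d} (hx : x ∈ interior T.carrier) : c.toFun x = c T :=
  glue_apply _ hx

theorem toFun_L1_apply {F : Type*} [AddCommGroup F] [Module ℝ F] (v : L1 𝒯 F) {T : 𝒯.Elem}
    {x : Euc d} (hx : x ∈ interior T.carrier) : v.toFun x = v T x :=
  glue_apply _ hx

/-- `Π_h` evaluates element-wise affine functions at the barycenters. -/
theorem proj_L1 {F : Type*} [NormedAddCommGroup F] [NormedSpace ℝ F] [CompleteSpace F]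
    (v : L1 𝒯 F) (T : 𝒯.Elem) : 𝒯.proj v.toFun T = v T T.center := by
  rw [proj, ← T.setAverage_affineMap (v T), setAverage_eq, setAverage_eq,
    ← setIntegral_congr_set T.interior_ae_eq, ← setIntegral_congr_set T.interior_ae_eq,
    setIntegral_congr_fun isOpen_interior.measurableSet fun x hx => toFun_L1_apply v hx]

theorem proj_id (T : 𝒯.Elem) : 𝒯.proj (fun x => x) T = T.center := T.setAverage_id

end ROF.Triangulation

namespace ROF.Triangulation

variable {d : ℕ} {Ω : Set (Euc d)} {𝒯 : Triangulation Ω}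

/-! ### Normals and side areas -/

namespace Elem

variable {T T' : 𝒯.Elem} {S : Finset (Euc d)}

theorem affineGrad_height_ne_zero (hd : 1 ≤ d) (hS : T.IsSide S) : affineGrad (T.height S) ≠ 0 := by
  classical
  intro h
  obtain ⟨p, hp, hT⟩ := hS.exists_insert
  have h1 := inner_sub_affineGrad (T.height S) p (sideBarycenter S)
  rw [h, inner_zero_right, height_eq_zero_of_mem hS (sideBarycenter_mem hd hS.2),
    height_vertex (by rw [hT]; simp), if_neg hp] at h1
  norm_num at h1

/-- The outward unit normal on a side is the normalized negative gradient of the height. -/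
theorem isOutwardNormal_iff (hd : 1 ≤ d) (hS : T.IsSide S) {n : Euc d} :
    T.IsOutwardNormal S n ↔ n = -‖affineGrad (T.height S)‖⁻¹ • affineGrad (T.height S) := by
  classical
  have hG := norm_pos_iff.2 (affineGrad_height_ne_zero hd hS)
  have hzero : ∀ x ∈ S, T.height S x = 0 := fun x hx =>
    height_eq_zero_of_mem hS (subset_convexHull ℝ _ hx)
  constructor
  · rintro ⟨hn, hort, hout⟩
    obtain ⟨p, hp, hT⟩ := hS.exists_insert
    obtain ⟨x₀, hx₀⟩ : S.Nonempty := Finset.card_pos.1 (by rw [hS.2]; exact hd)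
    let v : Euc d →ᵃ[ℝ] ℝ := (innerSL ℝ n).toLinearMap.toAffineMap -
      AffineMap.const ℝ _ (inner ℝ n x₀)
    have hv : ∀ x, v x = inner ℝ (x - x₀) n := fun x => by
      rw [inner_sub_left, real_inner_comm, real_inner_comm _ x₀]; rfl
    have hvn : affineGrad v = n := by
      refine ext_inner_left ℝ fun w => ?_
      have h := inner_sub_affineGrad v (w + x₀) x₀
      rw [hv, hv, add_sub_cancel_right, sub_self, inner_zero_left, sub_zero] at h
      exact h
    have h := congrArg affineGrad (eq_smul_height hp hT fun q hq => (hv q).trans (hort _ hx₀ _ hq))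
    have hneg : v p < 0 := (hv p).trans_lt (hout _ hx₀ _ (by rw [hT]; simp) hp)
    rw [hvn, map_smul] at h
    rw [h, norm_smul, Real.norm_eq_abs, abs_of_neg hneg] at hn
    rw [h]
    congr 1
    field_simp
    linarith
  · rintro rfl
    refine ⟨?_, fun x hx y hy => ?_, fun x hx p hp hpS => ?_⟩
    · rw [norm_smul, norm_neg, norm_inv, norm_norm, inv_mul_cancel₀ hG.ne']
    · rw [inner_smul_right, inner_sub_affineGrad, hzero x hx, hzero y hy]; simp
    · rw [inner_smul_right, inner_sub_affineGrad, hzero x hx, height_vertex hp, if_neg hpS]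
      simpa using hG

/-- `|T| |∇ height|` is the area of the side divided by `d`, hence the same for both
elements which share the side. -/
theorem vol_mul_norm_affineGrad_height (hd : 1 ≤ d) (hne : T ≠ T') (hS : T.IsSide S)
    (hS' : T'.IsSide S) :
    T'.vol * ‖affineGrad (T'.height S)‖ = T.vol * ‖affineGrad (T.height S)‖ := by
  classical
  obtain ⟨p', hp', hT'⟩ := hS'.exists_insert
  rw [vol_eq_mul_vol hd hne hS hp' hT', height_eq_smul_height hS hp' hT', map_smul, norm_smul,
    Real.norm_eq_abs, abs_of_neg (height_opposite_neg hd hne hS hp' hT'),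
    ← height_eq_smul_height hS hp' hT']
  ring

end Elem

/-! ### Crouzeix-Raviart basis functions -/

theorem grad_apply (v : L1 𝒯 ℝ) (T : 𝒯.Elem) : grad v T = affineGrad (v T) := rfl

open Classical in
/-- The Crouzeix-Raviart basis function of the side `S`: it is `1` at the barycenter of `S` and `0`
at the barycenters of all other sides. -/
noncomputable def crBasis (𝒯 : Triangulation Ω) (S : Finset (Euc d)) : L1 𝒯 ℝ :=
  fun T => if T.IsSide S then AffineMap.const ℝ _ 1 - (d : ℝ) • T.height S else 0

theorem crBasis_apply_of_isSide {S : Finset (Euc d)} {T : 𝒯.Elem} (hS : T.IsSide S) (x : Euc d) :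
    crBasis 𝒯 S T x = 1 - d * T.height S x := by
  rw [crBasis, if_pos hS]; rfl

theorem crBasis_mem_CR (hd : 1 ≤ d) (S : Finset (Euc d)) : crBasis 𝒯 S ∈ 𝒯.CR := by
  classical
  have key : ∀ (S' : Finset (Euc d)) (T : 𝒯.Elem), T.IsSide S' →
      crBasis 𝒯 S T (sideBarycenter S') = if S' = S then 1 else 0 := by
    intro S' T hS'
    by_cases hS : T.IsSide S
    · rw [crBasis_apply_of_isSide hS]
      split_ifs with h
      · subst h
        rw [Elem.height_eq_zero_of_mem hS (sideBarycenter_mem hd hS.2)]; ring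
      · obtain ⟨p, hp, hT⟩ := hS.exists_insert
        have hpS' : p ∈ S' := by
          by_contra hpS'
          refine h (Finset.eq_of_subset_of_card_le (fun q hq => ?_) (by rw [hS.2, hS'.2]))
          have := hS'.1 hq
          rw [hT, Finset.mem_insert] at this
          exact this.resolve_left (by rintro rfl; exact hpS' hq)
        rw [apply_sideBarycenter hd _ hS'.2,
          Finset.sum_congr rfl fun q hq => Elem.height_vertex (hS'.1 hq),
          Finset.sum_eq_single_of_mem p hpS', if_neg hp]
        · have : (d : ℝ) ≠ 0 := by positivity
          rw [smul_eq_mul]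
          field_simp
          ring
        · intro q hq hqp
          have := hS'.1 hq
          rw [hT, Finset.mem_insert] at this
          rw [if_pos (this.resolve_left hqp)]
    · rw [crBasis, if_neg hS, if_neg]
      · rfl
      · rintro rfl; exact hS hS'
  intro S' T T' hT hT'
  rw [key S' T hT, key S' T' hT']

/-- On each element, a function is the combination of Crouzeix-Raviart basis functions with
its values at the barycenters of the sides as coefficients. -/
theorem eq_sum_crBasis [DecidableEq (Euc d)] (hd : 1 ≤ d) (T : 𝒯.Elem) (v : Euc d →ᵃ[ℝ] ℝ) :
    v = ∑ p ∈ T.1, v (sideBarycenter (T.1.erase p)) • crBasis 𝒯 (T.1.erase p) T := by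
  classical
  have hside : ∀ p ∈ T.1, T.IsSide (T.1.erase p) := fun p hp =>
    ⟨Finset.erase_subset _ _, by rw [Finset.card_erase_of_mem hp, T.2.2]; rfl⟩
  have hd0 : (d : ℝ) ≠ 0 := by positivity
  refine Elem.affineMap_ext (T := T) fun q hq => ?_
  rw [affineMap_sum_apply]
  have hbary : ∀ p ∈ T.1, (d : ℝ) * v (sideBarycenter (T.1.erase p)) = (∑ z ∈ T.1, v z) - v p := by
    intro p hp
    rw [apply_sideBarycenter hd v (hside p hp).2, smul_eq_mul, mul_inv_cancel_left₀ hd0,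
      Finset.sum_erase_eq_sub hp]
  have hterm : ∀ p ∈ T.1, (v (sideBarycenter (T.1.erase p)) • crBasis 𝒯 (T.1.erase p) T) q =
      v (sideBarycenter (T.1.erase p)) -
        if p = q then (d : ℝ) * v (sideBarycenter (T.1.erase p)) else 0 := by
    intro p hp
    rw [AffineMap.coe_smul, Pi.smul_apply, crBasis_apply_of_isSide (hside p hp),
      Elem.height_vertex hq]
    by_cases hpq : p = q
    · subst hpq; simp; ring
    · simp [hpq, hq, Ne.symm hpq]
  rw [Finset.sum_congr rfl hterm, Finset.sum_sub_distrib, Finset.sum_ite_eq' T.1 q,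
    if_pos hq, hbary q hq]
  have hsum : (d : ℝ) * ∑ p ∈ T.1, v (sideBarycenter (T.1.erase p)) = d * ∑ z ∈ T.1, v z := by
    rw [Finset.mul_sum, Finset.sum_congr rfl hbary, Finset.sum_sub_distrib, Finset.sum_const,
      T.2.2, nsmul_eq_mul]
    push_cast; ring
  rw [mul_left_cancel₀ hd0 hsum]
  ring

/-! ### Raviart-Thomas fields -/

/-- The vector field which is `a T + c T • (id - center)` on the element `T`. -/
noncomputable def rtField (a : L0 𝒯 (Euc d)) (c : L0 𝒯 ℝ) : L1 𝒯 (Euc d) :=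
  fun T => AffineMap.const ℝ (Euc d) (a T) +
    c T • (AffineMap.id ℝ (Euc d) - AffineMap.const ℝ (Euc d) T.center)

theorem rtField_apply (a : L0 𝒯 (Euc d)) (c : L0 𝒯 ℝ) (T : 𝒯.Elem) (x : Euc d) :
    rtField a c T x = a T + c T • (x - T.center) := rfl

theorem proj_rtField (a : L0 𝒯 (Euc d)) (c : L0 𝒯 ℝ) : 𝒯.proj (rtField a c).toFun = a := by
  ext1 T
  rw [proj_L1, rtField_apply, sub_self, smul_zero, add_zero]

theorem div_rtField (a : L0 𝒯 (Euc d)) (c : L0 𝒯 ℝ) (T : 𝒯.Elem) :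
    div (rtField a c) T = d * c T := by
  have h : (rtField a c T).linear = c T • LinearMap.id := by
    ext1 w
    simp [rtField]
  rw [div, h, map_smul, LinearMap.trace_id]
  simp [mul_comm]

/-- The discrete pairing `∫ a · ∇_h v + (div y) Π_h v` for `y = rtField a c`. -/
noncomputable def pairing (a : L0 𝒯 (Euc d)) (c : L0 𝒯 ℝ) (v : L1 𝒯 ℝ) : ℝ :=
  ∑ T, T.vol * (inner ℝ (a T) (grad v T) + d * c T * v T T.center)

/-- The component of `rtField a c` in the direction of the gradient of the height over the
side `S`, see `inner_rtField`. -/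
noncomputable def sideFlux (a : L0 𝒯 (Euc d)) (c : L0 𝒯 ℝ) (T : 𝒯.Elem) (S : Finset (Euc d)) : ℝ :=
  inner ℝ (a T) (affineGrad (T.height S)) - c T * ((d : ℝ) + 1)⁻¹

theorem inner_rtField (a : L0 𝒯 (Euc d)) (c : L0 𝒯 ℝ) {T : 𝒯.Elem} {S : Finset (Euc d)}
    (hS : T.IsSide S) {x : Euc d} (hx : x ∈ convexHull ℝ (S : Set (Euc d))) :
    inner ℝ (rtField a c T x) (affineGrad (T.height S)) = sideFlux a c T S := by
  rw [rtField_apply, inner_add_left, real_inner_smul_left, inner_sub_affineGrad,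
    Elem.height_eq_zero_of_mem hS hx, Elem.height_center hS, sideFlux]
  ring

theorem pairing_crBasis_local (a : L0 𝒯 (Euc d)) (c : L0 𝒯 ℝ) {T : 𝒯.Elem}
    {S : Finset (Euc d)} (hS : T.IsSide S) :
    inner ℝ (a T) (affineGrad (crBasis 𝒯 S T)) + d * c T * crBasis 𝒯 S T T.center =
      -d * sideFlux a c T S := by
  have h : affineGrad (crBasis 𝒯 S T) = -(d : ℝ) • affineGrad (T.height S) := by
    have h0 : affineGrad (AffineMap.const ℝ (Euc d) (1 : ℝ)) = 0 :=
      ext_inner_left ℝ fun w => by rw [inner_affineGrad]; simp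
    rw [crBasis, if_pos hS, map_sub, map_smul, h0, zero_sub, neg_smul]
  rw [h, crBasis_apply_of_isSide hS, Elem.height_center hS, inner_smul_right, sideFlux]
  field_simp
  ring

open Classical in
theorem pairing_crBasis (a : L0 𝒯 (Euc d)) (c : L0 𝒯 ℝ) (S : Finset (Euc d)) :
    pairing a c (crBasis 𝒯 S) =
      -d * ∑ T : 𝒯.Elem, if T.IsSide S then T.vol * sideFlux a c T S else 0 := by
  rw [pairing, Finset.mul_sum]
  refine Finset.sum_congr rfl fun T _ => ?_
  split_ifs with hS
  · rw [grad_apply, pairing_crBasis_local a c hS]; ring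
  · have h0 : crBasis 𝒯 S T = 0 := by rw [crBasis, if_neg hS]
    rw [grad_apply, h0, map_zero]
    simp

open Classical in
/-- The pairing with all Crouzeix-Raviart functions vanishes if and only if the fluxes through each
side add up to zero. -/
theorem pairing_eq_zero_iff (hd : 1 ≤ d) (a : L0 𝒯 (Euc d)) (c : L0 𝒯 ℝ) :
    (∀ v ∈ 𝒯.CR, pairing a c v = 0) ↔
      ∀ S, ∑ T : 𝒯.Elem, (if T.IsSide S then T.vol * sideFlux a c T S else 0) = 0 := by
  have hd0 : (d : ℝ) ≠ 0 := by positivity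
  constructor
  · intro h S
    have := h _ (crBasis_mem_CR hd S)
    rw [pairing_crBasis] at this
    exact (mul_eq_zero.1 this).resolve_left (neg_ne_zero.2 hd0)
  · intro h v hv
    let 𝓕 : Finset (Finset (Euc d)) := Finset.univ.biUnion fun T : 𝒯.Elem => T.1.powersetCard d
    have hlocal : ∀ T : 𝒯.Elem, T.vol * (inner ℝ (a T) (grad v T) + d * c T * v T T.center) =
        ∑ S ∈ 𝓕, if T.IsSide S then
          -d * v T (sideBarycenter S) * (T.vol * sideFlux a c T S) else 0 := by
      intro T
      have hfilter : 𝓕.filter (fun S => T.IsSide S) = T.1.image fun p => T.1.erase p := by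
        ext S
        simp only [𝓕, Finset.mem_filter, Finset.mem_biUnion, Finset.mem_univ, true_and,
          Finset.mem_powersetCard, Finset.mem_image]
        constructor
        · rintro ⟨-, hS⟩
          obtain ⟨p, hp, hT⟩ := hS.exists_insert
          exact ⟨p, by rw [hT]; simp, by rw [hT, Finset.erase_insert hp]⟩
        · rintro ⟨p, hp, rfl⟩
          have hS : T.IsSide (T.1.erase p) :=
            ⟨Finset.erase_subset _ _, by rw [Finset.card_erase_of_mem hp, T.2.2]; rfl⟩
          exact ⟨⟨T, hS⟩, hS⟩
      rw [← Finset.sum_filter, hfilter, Finset.sum_image (Finset.erase_injOn T.1)]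
      have hv' := eq_sum_crBasis hd T (v T)
      have hgrad : grad v T = ∑ p ∈ T.1, v T (sideBarycenter (T.1.erase p)) •
          affineGrad (crBasis 𝒯 (T.1.erase p) T) := by
        rw [grad_apply]
        conv_lhs => rw [hv']
        rw [map_sum]
        simp_rw [map_smul]
      have hcenter : v T T.center = ∑ p ∈ T.1, v T (sideBarycenter (T.1.erase p)) *
          crBasis 𝒯 (T.1.erase p) T T.center := by
        conv_lhs => rw [hv']
        rw [affineMap_sum_apply]
        rfl
      rw [hgrad, hcenter, inner_sum, Finset.mul_sum, ← Finset.sum_add_distrib, Finset.mul_sum]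
      refine Finset.sum_congr rfl fun p hp => ?_
      have hS : T.IsSide (T.1.erase p) :=
        ⟨Finset.erase_subset _ _, by rw [Finset.card_erase_of_mem hp, T.2.2]; rfl⟩
      have := pairing_crBasis_local a c hS
      rw [inner_smul_right]
      linear_combination T.vol * v T (sideBarycenter (T.1.erase p)) * this
    rw [pairing, Finset.sum_congr rfl fun T _ => hlocal T, Finset.sum_comm]
    refine Finset.sum_eq_zero fun S _ => ?_
    by_cases hex : ∃ T₀ : 𝒯.Elem, T₀.IsSide S
    · obtain ⟨T₀, hT₀⟩ := hex
      have : ∀ T : 𝒯.Elem, (if T.IsSide S then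
          -d * v T (sideBarycenter S) * (T.vol * sideFlux a c T S) else 0) =
          -d * v T₀ (sideBarycenter S) * if T.IsSide S then T.vol * sideFlux a c T S else 0 := by
        intro T
        split_ifs with hT
        · rw [hv S T T₀ hT hT₀]
        · simp
      rw [Finset.sum_congr rfl fun T _ => this T, ← Finset.mul_sum, h S, mul_zero]
    · exact Finset.sum_eq_zero fun T _ => if_neg fun hT => hex ⟨T, hT⟩

open Classical in
theorem rtField_mem_RTN_iff_sideFlux (hd : 1 ≤ d) (a : L0 𝒯 (Euc d)) (c : L0 𝒯 ℝ) :
    rtField a c ∈ 𝒯.RTN ↔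
      ∀ S, ∑ T : 𝒯.Elem, (if T.IsSide S then T.vol * sideFlux a c T S else 0) = 0 := by
  have hinner : ∀ (T : 𝒯.Elem) (S : Finset (Euc d)) (n : Euc d), T.IsSide S →
      T.IsOutwardNormal S n → ∀ x ∈ convexHull ℝ (S : Set (Euc d)),
      inner ℝ (rtField a c T x) n = -‖affineGrad (T.height S)‖⁻¹ * sideFlux a c T S := by
    intro T S n hS hn x hx
    rw [(Elem.isOutwardNormal_iff hd hS).1 hn, inner_smul_right, inner_rtField a c hS hx]
  have hpos : ∀ (T : 𝒯.Elem) (S : Finset (Euc d)), T.IsSide S →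
      0 < ‖affineGrad (T.height S)‖ := fun T S hS =>
    norm_pos_iff.2 (Elem.affineGrad_height_ne_zero hd hS)
  have htwo : ∀ (T T' : 𝒯.Elem) (S : Finset (Euc d)), T ≠ T' → T.IsSide S → T'.IsSide S →
      (∑ T : 𝒯.Elem, (if T.IsSide S then T.vol * sideFlux a c T S else 0) =
        -(T.vol * ‖affineGrad (T.height S)‖) *
          (-‖affineGrad (T.height S)‖⁻¹ * sideFlux a c T S +
            -‖affineGrad (T'.height S)‖⁻¹ * sideFlux a c T' S)) := by
    intro T T' S hne hS hS'
    rw [Fintype.sum_eq_add T T' hne, if_pos hS, if_pos hS']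
    · have h1 := Elem.vol_mul_norm_affineGrad_height hd hne hS hS'
      have h2 := hpos T S hS
      have h3 := hpos T' S hS'
      have h4 : T'.vol = T.vol * ‖affineGrad (T.height S)‖ / ‖affineGrad (T'.height S)‖ := by
        rw [← h1, mul_div_assoc, div_self h3.ne', mul_one]
      rw [h4]
      field_simp
      ring
    · rintro T'' ⟨h1, h2⟩
      refine if_neg fun hS'' => ?_
      rcases Elem.eq_or_eq_of_isSide hd hne hS hS' hS'' with h | h
      exacts [h1 h, h2 h]
  have hone : ∀ (T : 𝒯.Elem) (S : Finset (Euc d)), T.IsBoundarySide S →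
      (∑ T : 𝒯.Elem, (if T.IsSide S then T.vol * sideFlux a c T S else 0) =
        T.vol * sideFlux a c T S) := by
    intro T S hS
    rw [Fintype.sum_eq_single T fun T' hne => if_neg fun hS' => hne (hS.2 T' hS'), if_pos hS.1]
  constructor
  · rintro ⟨-, hjump, hbdry⟩ S
    by_cases hex : ∃ T : 𝒯.Elem, T.IsSide S
    · obtain ⟨T, hS⟩ := hex
      have hn := (Elem.isOutwardNormal_iff hd hS).2 rfl
      have hx := sideBarycenter_mem hd hS.2
      by_cases hb : T.IsBoundarySide S
      · have h := hbdry T S _ hb hn _ hx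
        rw [hinner T S _ hS hn _ hx] at h
        rw [hone T S hb, (mul_eq_zero.1 h).resolve_left
          (neg_ne_zero.2 (inv_ne_zero (hpos T S hS).ne')), mul_zero]
      · obtain ⟨T', hS', hne⟩ : ∃ T' : 𝒯.Elem, T'.IsSide S ∧ T' ≠ T := by
          by_contra! hall
          exact hb ⟨hS, hall⟩
        have hn' := (Elem.isOutwardNormal_iff hd hS').2 rfl
        have h := hjump T T' S _ _ hne.symm hS hS' hn hn' _ hx
        rw [hinner T S _ hS hn _ hx, hinner T' S _ hS' hn' _ hx] at h
        rw [htwo T T' S hne.symm hS hS', h, mul_zero]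
    · exact Finset.sum_eq_zero fun T _ => if_neg fun hT => hex ⟨T, hT⟩
  · intro h
    refine ⟨fun T S n hS hn => ⟨_, hinner T S n hS hn⟩, ?_, ?_⟩
    · intro T T' S n n' hne hS hS' hn hn' x hx
      rw [hinner T S _ hS hn _ hx, hinner T' S _ hS' hn' _ hx]
      have h' := h S
      rw [htwo T T' S hne hS hS'] at h'
      exact (mul_eq_zero.1 h').resolve_left
        (neg_ne_zero.2 (mul_pos T.vol_pos (hpos T S hS)).ne')
    · intro T S n hb hn x hx
      have h' := h S
      rw [hone T S hb] at h'
      rw [hinner T S n hb.1 hn x hx, (mul_eq_zero.1 h').resolve_left T.vol_pos.ne', mul_zero]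

end ROF.Triangulation

namespace ROF.Triangulation

variable {d : ℕ} {Ω : Set (Euc d)} {𝒯 : Triangulation Ω}

/-- An affine field whose normal components are constant on the sides of a simplex is of the form
`a + c (id - center)`: its linear part has the eigenvectors `q - p`, for all vertices `p`, `q`, with
one common eigenvalue. -/
theorem exists_eq_rtField_of_mem_RTN (hd : 1 ≤ d) {y : L1 𝒯 (Euc d)} (hy : y ∈ 𝒯.RTN) :
    ∃ a c, y = rtField a c := by
  classical
  suffices h : ∀ T : 𝒯.Elem, ∃ c : ℝ, ∀ x, y T x = y T T.center + c • (x - T.center) by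
    choose c hc using h
    exact ⟨fun T => y T T.center, c, funext fun T => AffineMap.ext fun x => hc T x⟩
  intro T
  let L := (y T).linear
  have hL : ∀ x z, y T x - y T z = L (x - z) := fun x z => ((y T).linearMap_vsub x z).symm
  -- `M p r s` is the derivative of `y T` along the edge from `s` to `r`, in the direction normal to
  -- the side opposite to `p`
  let M : T.1 → T.1 → T.1 → ℝ := fun p r s => (T.basis.coord p).linear (L ((r : Euc d) - s))
  have hMsymm : ∀ p r s, M p r s = -M p s r := fun p r s => by
    simp only [M]; rw [← neg_sub, map_neg, map_neg]
  have hMadd : ∀ p r s t, M p r t = M p r s + M p s t := fun p r s t => by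
    simp only [M]; rw [← map_add, ← map_add, sub_add_sub_cancel]
  -- constancy of the normal component on the side opposite to `p`
  have hM0 : ∀ p r s, r ≠ p → s ≠ p → M p r s = 0 := by
    intro p r s hr hs
    have hS : T.IsSide (T.1.erase p) :=
      ⟨Finset.erase_subset _ _, by rw [Finset.card_erase_of_mem p.2, T.2.2]; rfl⟩
    have hcoord : T.basis.coord p = T.height (T.1.erase p) := by
      refine Elem.affineMap_ext (T := T) fun q hq => ?_
      rw [Elem.height_vertex hq]
      change T.basis.coord p (T.basis ⟨q, hq⟩) = _
      rw [AffineBasis.coord_apply]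
      by_cases h : q = p
      · subst h; simp
      · rw [if_neg fun h' => h (congrArg Subtype.val h').symm,
          if_pos (Finset.mem_erase.2 ⟨h, hq⟩)]
    have hn := (Elem.isOutwardNormal_iff hd hS).2 rfl
    obtain ⟨k, hk⟩ := hy.1 T _ _ hS hn
    have hmem : ∀ q : T.1, q ≠ p → (q : Euc d) ∈ convexHull ℝ ((T.1.erase p : Finset _) : Set _) :=
      fun q hq => subset_convexHull ℝ _
        (Finset.mem_coe.2 (Finset.mem_erase.2 ⟨fun h => hq (Subtype.ext h), q.2⟩))
    have h1 := hk _ (hmem r hr)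
    rw [← hk _ (hmem s hs), ← sub_eq_zero, ← inner_sub_left, hL, inner_smul_right,
      inner_affineGrad, ← hcoord] at h1
    exact (mul_eq_zero.1 h1).resolve_left
      (neg_ne_zero.2 (inv_ne_zero (norm_ne_zero_iff.2
        (hcoord ▸ Elem.affineGrad_height_ne_zero hd hS))))
  have hMsum : ∀ r s, ∑ p, M p r s = 0 := by
    intro r s
    have h : ∀ w : Euc d, ∑ p, (T.basis.coord p).linear w = 0 := by
      intro w
      have h1 := T.basis.sum_coord_apply_eq_one w
      rw [← T.basis.sum_coord_apply_eq_one 0, ← sub_eq_zero, ← Finset.sum_sub_distrib] at h1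
      rw [← h1]
      refine Finset.sum_congr rfl fun p _ => ?_
      have h2 := (T.basis.coord p).linearMap_vsub w 0
      simpa using h2
    exact h _
  have hMswap : ∀ r s, r ≠ s → M s r s = -M r r s := by
    intro r s hrs
    have h := hMsum r s
    rw [Fintype.sum_eq_add r s hrs fun p hp => hM0 p r s hp.1.symm hp.2.symm] at h
    linarith
  have hcard : 1 < Fintype.card T.1 := by
    rw [Fintype.card_coe, T.2.2]; omega
  obtain ⟨p₀, q₀, hpq₀⟩ := Fintype.exists_pair_of_one_lt_card hcard
  -- the common eigenvalue
  let c := M p₀ p₀ q₀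
  have hlin : ∀ q : T.1, L ((q : Euc d) - p₀) = c • ((q : Euc d) - p₀) := by
    intro q
    by_cases hq : q = p₀
    · rw [hq]; simp
    have hc : M p₀ p₀ q = c := by
      rw [hMadd p₀ p₀ q₀ q, hM0 p₀ q₀ q hpq₀.symm hq, add_zero]
    rw [← sub_eq_zero]
    have hzero : ∀ r, (T.basis.coord r).linear
        (L ((q : Euc d) - p₀) - c • ((q : Euc d) - p₀)) = 0 := by
      intro r
      have h1 := (T.basis.coord r).linearMap_vsub (T.basis q) (T.basis p₀)
      rw [AffineBasis.coord_apply, AffineBasis.coord_apply] at h1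
      change (T.basis.coord r).linear ((q : Euc d) - p₀) = _ at h1
      rw [map_sub, map_smul, h1]
      change M r q p₀ - _ = 0
      by_cases hr : r = q
      · subst hr
        rw [hMsymm, hMswap p₀ r (Ne.symm hq), hc]
        simp [hq]
      · by_cases hr' : r = p₀
        · subst hr'
          rw [hMsymm, hc]
          simp [hr]
        · rw [hM0 r q p₀ (Ne.symm hr) (Ne.symm hr')]
          simp [hr, hr']
    set w := L ((q : Euc d) - p₀) - c • ((q : Euc d) - p₀)
    refine T.basis.ext_elem fun r => ?_
    have h3 := (T.basis.coord r).linearMap_vsub w 0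
    rw [vsub_eq_sub, sub_zero, hzero r, vsub_eq_sub] at h3
    linarith
  have hB : y T = AffineMap.const ℝ (Euc d) (y T p₀ - c • (p₀ : Euc d)) +
      c • AffineMap.id ℝ (Euc d) := by
    refine Elem.affineMap_ext (T := T) fun q hq => ?_
    change _ = (y T p₀ - c • (p₀ : Euc d)) + c • q
    have h := hL q p₀
    rw [hlin ⟨q, hq⟩, smul_sub] at h
    rw [sub_eq_iff_eq_add.1 h]
    abel
  refine ⟨c, fun x => ?_⟩
  have hx : ∀ x, y T x = (y T p₀ - c • (p₀ : Euc d)) + c • x :=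
    fun x => congrArg (fun v : Euc d →ᵃ[ℝ] Euc d => v x) hB
  rw [hx x, hx T.center, smul_sub]
  abel

/-- The Raviart-Thomas fields are those fields `rtField a c` which satisfy the discrete integration
by parts formula with all Crouzeix-Raviart functions. -/
theorem rtField_mem_RTN_iff (hd : 1 ≤ d) (a : L0 𝒯 (Euc d)) (c : L0 𝒯 ℝ) :
    rtField a c ∈ 𝒯.RTN ↔ ∀ v ∈ 𝒯.CR, pairing a c v = 0 := by
  rw [rtField_mem_RTN_iff_sideFlux hd, pairing_eq_zero_iff hd]

theorem marini_eq_rtField (α : ℝ) (g : Euc d → ℝ) (ε : L0 𝒯 ℝ) (u : L1 𝒯 ℝ) :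
    𝒯.marini α g ε u = rtField
      (fun T => (deriv (fReg (ε T)) ‖grad u T‖ / ‖grad u T‖) • grad u T)
      (fun T => α * ((u T T.center - 𝒯.proj g T) / d)) := by
  funext T
  rw [marini, proj_id, proj_L1]
  rfl

end ROF.Triangulation

namespace ROF

/-! ### The finite-dimensional minimization problem -/

variable {ι H : Type*} [Fintype ι] [NormedAddCommGroup H]

/-- The flux `f_ε'(|a|)/|a| a = (1 - ε) a / (|a|² + ε²)^{1/2}`. -/
noncomputable def regFlux [InnerProductSpace ℝ H] (ε : ℝ) (a : H) : H :=
  ((1 - ε) / √(‖a‖ ^ 2 + ε ^ 2)) • a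

section Scalar

variable {ε : ℝ} [InnerProductSpace ℝ H]

theorem sqrt_sq_add_sq_pos (hε : 0 < ε) (t : ℝ) : 0 < √(t ^ 2 + ε ^ 2) :=
  Real.sqrt_pos.2 (by positivity)

theorem fReg_nonneg (hε : ε < 1) (t : ℝ) : 0 ≤ fReg ε t :=
  mul_nonneg (by linarith) (Real.sqrt_nonneg _)

theorem mul_le_fReg (hε : ε < 1) (t : ℝ) : (1 - ε) * t ≤ fReg ε t :=
  mul_le_mul_of_nonneg_left (Real.le_sqrt_of_sq_le (by nlinarith [sq_nonneg ε])) (by linarith)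

theorem hasDerivAt_fReg (hε : 0 < ε) (t : ℝ) :
    HasDerivAt (fReg ε) ((1 - ε) * (t / √(t ^ 2 + ε ^ 2))) t := by
  have h1 : HasDerivAt (fun t : ℝ => t ^ 2 + ε ^ 2) (2 * t) t := by
    simpa using (hasDerivAt_pow 2 t).add_const (ε ^ 2)
  have h2 := (h1.sqrt (by positivity)).const_mul (1 - ε)
  refine h2.congr_deriv ?_
  rw [mul_div_mul_left _ _ two_ne_zero]

theorem deriv_fReg_smul (hε : 0 < ε) (a : H) :
    (deriv (fReg ε) ‖a‖ / ‖a‖) • a = regFlux ε a := by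
  rcases eq_or_ne a 0 with rfl | ha
  · simp [regFlux]
  · have h := norm_pos_iff.2 ha
    have := sqrt_sq_add_sq_pos hε ‖a‖
    rw [(hasDerivAt_fReg hε _).deriv, regFlux]
    congr 1
    field_simp

theorem norm_regFlux_le (hε : 0 < ε) (hε1 : ε < 1) (a : H) : ‖regFlux ε a‖ ≤ 1 := by
  have h := sqrt_sq_add_sq_pos hε ‖a‖
  have h1 : ‖a‖ ≤ √(‖a‖ ^ 2 + ε ^ 2) := Real.le_sqrt_of_sq_le (by nlinarith [sq_nonneg ε])
  rw [regFlux, norm_smul, Real.norm_of_nonneg (div_nonneg (by linarith) h.le), div_mul_eq_mul_div,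
    div_le_one h]
  nlinarith [norm_nonneg a]

/-- The flux is almost aligned with `a`: `p · a ≥ (1 - ε) (|a| - ε)`. -/
theorem le_inner_regFlux (hε : 0 < ε) (hε1 : ε < 1) (a : H) :
    (1 - ε) * (‖a‖ - ε) ≤ inner ℝ (regFlux ε a) a := by
  have h := sqrt_sq_add_sq_pos hε ‖a‖
  have hsq : √(‖a‖ ^ 2 + ε ^ 2) ^ 2 = ‖a‖ ^ 2 + ε ^ 2 := Real.sq_sqrt (by positivity)
  have h1 : √(‖a‖ ^ 2 + ε ^ 2) ≤ ‖a‖ + ε :=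
    Real.sqrt_le_iff.2 ⟨by positivity, by nlinarith [norm_nonneg a]⟩
  rw [regFlux, real_inner_smul_left, real_inner_self_eq_norm_sq, div_mul_eq_mul_div, le_div_iff₀ h,
    mul_assoc]
  refine mul_le_mul_of_nonneg_left ?_ (by linarith)
  rcases le_total ‖a‖ ε with h2 | h2
  · nlinarith [sq_nonneg ‖a‖, mul_nonneg (sub_nonneg.2 h2) h.le]
  · nlinarith [mul_le_mul_of_nonneg_left h1 (sub_nonneg.2 h2), sq_nonneg ε]

theorem hasDerivAt_fReg_norm (hε : 0 < ε) (a b : H) :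
    HasDerivAt (fun s : ℝ => fReg ε ‖a + s • b‖) (inner ℝ (regFlux ε a) b) 0 := by
  have h1 : HasDerivAt (fun s : ℝ => ‖a + s • b‖ ^ 2 + ε ^ 2) (2 * inner ℝ a b) 0 := by
    have h2 : (fun s : ℝ => ‖a + s • b‖ ^ 2 + ε ^ 2) =
        fun s : ℝ => ‖a‖ ^ 2 + s * (2 * inner ℝ a b) + s ^ 2 * ‖b‖ ^ 2 + ε ^ 2 := by
      funext s
      rw [norm_add_sq_real, inner_smul_right, norm_smul, mul_pow, Real.norm_eq_abs, sq_abs]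
      ring
    rw [h2]
    have h3 := (((hasDerivAt_id (0 : ℝ)).mul_const (2 * inner ℝ a b)).const_add (‖a‖ ^ 2)).add
      ((hasDerivAt_pow 2 (0 : ℝ)).mul_const (‖b‖ ^ 2))
    have h4 := h3.add_const (ε ^ 2)
    refine h4.congr_deriv ?_
    simp
  have h5 := (h1.sqrt (by positivity)).const_mul (1 - ε)
  refine h5.congr_deriv ?_
  rw [regFlux, real_inner_smul_left, zero_smul, add_zero]
  have := sqrt_sq_add_sq_pos hε ‖a‖
  field_simp

/-- Strict midpoint convexity of the regularized modulus. -/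
theorem fReg_midpoint_lt (hε : 0 < ε) (hε1 : ε < 1) {a b : H} (hab : a ≠ b) :
    fReg ε ‖(2⁻¹ : ℝ) • (a + b)‖ < (fReg ε ‖a‖ + fReg ε ‖b‖) / 2 := by
  have hA := sqrt_sq_add_sq_pos hε ‖a‖
  have hB := sqrt_sq_add_sq_pos hε ‖b‖
  have hA2 : √(‖a‖ ^ 2 + ε ^ 2) ^ 2 = ‖a‖ ^ 2 + ε ^ 2 := Real.sq_sqrt (by positivity)
  have hB2 : √(‖b‖ ^ 2 + ε ^ 2) ^ 2 = ‖b‖ ^ 2 + ε ^ 2 := Real.sq_sqrt (by positivity)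
  have hsub : 0 < ‖a‖ ^ 2 - 2 * inner ℝ a b + ‖b‖ ^ 2 := by
    rw [← norm_sub_sq_real]
    exact pow_pos (norm_pos_iff.2 (sub_ne_zero.2 hab)) 2
  have hCS : inner ℝ a b ^ 2 ≤ ‖a‖ ^ 2 * ‖b‖ ^ 2 := by
    rw [← mul_pow, ← sq_abs]
    exact pow_le_pow_left₀ (abs_nonneg _) (abs_real_inner_le_norm a b) 2
  have hprod : inner ℝ a b + ε ^ 2 < √(‖a‖ ^ 2 + ε ^ 2) * √(‖b‖ ^ 2 + ε ^ 2) := by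
    refine lt_of_pow_lt_pow_left₀ 2 (by positivity) ?_
    rw [mul_pow, hA2, hB2]
    nlinarith [mul_pos (pow_pos hε 2) hsub]
  rw [fReg, fReg, fReg, ← mul_add, mul_div_assoc]
  refine mul_lt_mul_of_pos_left ?_ (by linarith)
  rw [Real.sqrt_lt' (by positivity), norm_smul, mul_pow, norm_add_sq_real]
  norm_num
  nlinarith

end Scalar

section Energy

variable (w b : ι → ℝ) (α : ℝ)

/-- The energy `∑ w (|a| + α/2 (m - b)²)` as a function of gradients `a` and mean values `m`. -/
noncomputable def energy (x : (ι → H) × (ι → ℝ)) : ℝ :=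
  (∑ i, w i * ‖x.1 i‖) + α / 2 * ∑ i, w i * (x.2 i - b i) ^ 2

/-- The regularized energy. -/
noncomputable def energyReg (ε : ι → ℝ) (x : (ι → H) × (ι → ℝ)) : ℝ :=
  (∑ i, w i * fReg (ε i) ‖x.1 i‖) + α / 2 * ∑ i, w i * (x.2 i - b i) ^ 2

variable {w b α}

theorem continuous_energy : Continuous (energy (H := H) w b α) := by
  unfold energy; fun_prop

theorem continuous_energyReg (ε : ι → ℝ) : Continuous (energyReg (H := H) w b α ε) := by
  unfold energyReg fReg; fun_prop

/-- Coercivity: the factor `κ` covers both the energy and its regularizations, see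
`energyReg_lower_bound`. -/
theorem isBounded_sublevel (hw : ∀ i, 0 < w i) (hα : 0 < α) {κ : ℝ} (hκ : 0 < κ) (C : ℝ) :
    Bornology.IsBounded {x : (ι → H) × (ι → ℝ) |
      κ * (∑ i, w i * ‖x.1 i‖) + α / 2 * ∑ i, w i * (x.2 i - b i) ^ 2 ≤ C} := by
  have hterm : ∀ x : (ι → H) × (ι → ℝ),
      κ * (∑ i, w i * ‖x.1 i‖) + α / 2 * ∑ i, w i * (x.2 i - b i) ^ 2 ≤ C → ∀ i,
      ‖x.1 i‖ ≤ C / (κ * w i) ∧ |x.2 i| ≤ (C / (α / 2 * w i) + 1) + |b i| := by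
    intro x hx i
    have h1 : ∀ j ∈ Finset.univ, 0 ≤ w j * ‖x.1 j‖ := fun j _ =>
      mul_nonneg (hw j).le (norm_nonneg _)
    have h2 : ∀ j ∈ Finset.univ, 0 ≤ w j * (x.2 j - b j) ^ 2 := fun j _ =>
      mul_nonneg (hw j).le (sq_nonneg _)
    have h3 := mul_le_mul_of_nonneg_left (Finset.single_le_sum h1 (Finset.mem_univ i)) hκ.le
    have h4 := mul_le_mul_of_nonneg_left (Finset.single_le_sum h2 (Finset.mem_univ i))
      (half_pos hα).le
    have h5 := mul_nonneg hκ.le (h1 i (Finset.mem_univ i))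
    have h6 := mul_nonneg (half_pos hα).le (h2 i (Finset.mem_univ i))
    constructor
    · rw [le_div_iff₀ (mul_pos hκ (hw i))]
      nlinarith
    · have h7 : (x.2 i - b i) ^ 2 ≤ C / (α / 2 * w i) := by
        rw [le_div_iff₀ (mul_pos (half_pos hα) (hw i))]
        nlinarith
      have h8 : |x.2 i - b i| ≤ C / (α / 2 * w i) + 1 := by
        nlinarith [sq_abs (x.2 i - b i), sq_nonneg (|x.2 i - b i| - 1)]
      have h9 := abs_add_le (x.2 i - b i) (b i)
      rw [sub_add_cancel] at h9
      linarith
  refine Bornology.IsBounded.subset (isBounded_iff_forall_norm_le.2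
    ⟨(∑ i, |C / (κ * w i)|) + ∑ i, |C / (α / 2 * w i) + 1 + (|b i|)|, ?_⟩ : Bornology.IsBounded
      {x : (ι → H) × (ι → ℝ) | ∀ i,
      ‖x.1 i‖ ≤ C / (κ * w i) ∧ |x.2 i| ≤ (C / (α / 2 * w i) + 1) + |b i|}) hterm
  intro x hx
  have hs1 : 0 ≤ ∑ i, |C / (κ * w i)| := Finset.sum_nonneg fun _ _ => abs_nonneg _
  have hs2 : 0 ≤ ∑ i, |C / (α / 2 * w i) + 1 + (|b i|)| :=
    Finset.sum_nonneg fun _ _ => abs_nonneg _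
  refine norm_prod_le_iff.2 ⟨(pi_norm_le_iff_of_nonneg (by linarith)).2 fun i => ?_,
    (pi_norm_le_iff_of_nonneg (by linarith)).2 fun i => ?_⟩
  · have := Finset.single_le_sum (f := fun i => |C / (κ * w i)|) (fun _ _ => abs_nonneg _)
      (Finset.mem_univ i)
    exact ((hx i).1.trans (le_abs_self _)).trans (by linarith)
  · have := Finset.single_le_sum (f := fun i => |C / (α / 2 * w i) + 1 + (|b i|)|)
      (fun _ _ => abs_nonneg _) (Finset.mem_univ i)
    exact ((hx i).2.trans (le_abs_self _)).trans (by linarith)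

theorem energyReg_lower_bound (hw : ∀ i, 0 < w i) {ε : ι → ℝ} (hε : ∀ i, ε i < 1) {κ : ℝ}
    (hκ : ∀ i, κ ≤ 1 - ε i) (x : (ι → H) × (ι → ℝ)) :
    κ * (∑ i, w i * ‖x.1 i‖) + α / 2 * ∑ i, w i * (x.2 i - b i) ^ 2 ≤ energyReg w b α ε x := by
  refine add_le_add ?_ le_rfl
  rw [Finset.mul_sum]
  refine Finset.sum_le_sum fun i _ => ?_
  have h1 := mul_le_fReg (hε i) ‖x.1 i‖
  have h2 := mul_le_mul_of_nonneg_right (hκ i) (norm_nonneg (x.1 i))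
  nlinarith [hw i]

variable [InnerProductSpace ℝ H] {W : Submodule ℝ ((ι → H) × (ι → ℝ))}

/-- Uniqueness by strict midpoint convexity. -/
theorem eq_of_isMinOn_energyReg (hw : ∀ i, 0 < w i) (hα : 0 < α) {ε : ι → ℝ}
    (hε : ∀ i, 0 < ε i ∧ ε i < 1) {x y : (ι → H) × (ι → ℝ)} (hx : x ∈ W) (hy : y ∈ W)
    (hxm : IsMinOn (energyReg w b α ε) W x) (hym : IsMinOn (energyReg w b α ε) W y) : x = y := by
  by_contra hne
  have hzW : (2⁻¹ : ℝ) • (x + y) ∈ W := W.smul_mem _ (W.add_mem hx hy)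
  have h1 : energyReg w b α ε x ≤ energyReg w b α ε ((2⁻¹ : ℝ) • (x + y)) := hxm hzW
  have h2 : energyReg w b α ε y ≤ energyReg w b α ε ((2⁻¹ : ℝ) • (x + y)) := hym hzW
  have hF : ∀ i, w i * fReg (ε i) ‖(2⁻¹ : ℝ) • (x.1 i + y.1 i)‖ ≤
      w i * ((fReg (ε i) ‖x.1 i‖ + fReg (ε i) ‖y.1 i‖) / 2) := by
    intro i
    refine mul_le_mul_of_nonneg_left ?_ (hw i).le
    rcases eq_or_ne (x.1 i) (y.1 i) with h | h
    · rw [h, ← two_smul ℝ (y.1 i), smul_smul]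
      norm_num
    · exact (fReg_midpoint_lt (hε i).1 (hε i).2 h).le
  have hQ : ∀ i, w i * ((2⁻¹ : ℝ) * (x.2 i + y.2 i) - b i) ^ 2 ≤
      w i * (((x.2 i - b i) ^ 2 + (y.2 i - b i) ^ 2) / 2) := fun i =>
    mul_le_mul_of_nonneg_left (by nlinarith [sq_nonneg (x.2 i - y.2 i)]) (hw i).le
  have hsum : (∑ i, w i * fReg (ε i) ‖(2⁻¹ : ℝ) • (x.1 i + y.1 i)‖) +
      α / 2 * ∑ i, w i * ((2⁻¹ : ℝ) * (x.2 i + y.2 i) - b i) ^ 2 <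
      (∑ i, w i * ((fReg (ε i) ‖x.1 i‖ + fReg (ε i) ‖y.1 i‖) / 2)) +
      α / 2 * ∑ i, w i * (((x.2 i - b i) ^ 2 + (y.2 i - b i) ^ 2) / 2) := by
    by_cases h : x.1 = y.1
    · have h' : x.2 ≠ y.2 := fun h' => hne (Prod.ext h h')
      obtain ⟨i, hi⟩ := Function.ne_iff.1 h'
      refine add_lt_add_of_le_of_lt (Finset.sum_le_sum fun i _ => hF i)
        (mul_lt_mul_of_pos_left (Finset.sum_lt_sum (fun i _ => hQ i) ⟨i, Finset.mem_univ i, ?_⟩)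
          (half_pos hα))
      refine mul_lt_mul_of_pos_left ?_ (hw i)
      have := pow_pos (abs_pos.2 (sub_ne_zero.2 hi)) 2
      rw [sq_abs] at this
      nlinarith
    · obtain ⟨i, hi⟩ := Function.ne_iff.1 h
      refine add_lt_add_of_lt_of_le
        (Finset.sum_lt_sum (fun i _ => hF i) ⟨i, Finset.mem_univ i, ?_⟩)
        (mul_le_mul_of_nonneg_left (Finset.sum_le_sum fun i _ => hQ i) (half_pos hα).le)
      exact mul_lt_mul_of_pos_left (fReg_midpoint_lt (hε i).1 (hε i).2 hi) (hw i)
  have hmid : (∑ i, w i * ((fReg (ε i) ‖x.1 i‖ + fReg (ε i) ‖y.1 i‖) / 2)) +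
      α / 2 * ∑ i, w i * (((x.2 i - b i) ^ 2 + (y.2 i - b i) ^ 2) / 2) =
      (energyReg w b α ε x + energyReg w b α ε y) / 2 := by
    unfold energyReg
    simp_rw [← mul_div_assoc, mul_add, ← Finset.sum_div, Finset.sum_add_distrib]
    ring
  rw [hmid] at hsum
  have h3 : energyReg w b α ε ((2⁻¹ : ℝ) • (x + y)) <
    (energyReg w b α ε x + energyReg w b α ε y) / 2 := hsum
  linarith

/-- The Euler-Lagrange equation of the regularized problem. -/
theorem eulerLagrange {ε : ι → ℝ} (hε : ∀ i, 0 < ε i) {x : (ι → H) × (ι → ℝ)} (hx : x ∈ W)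
    (hmin : IsMinOn (energyReg w b α ε) W x) {y : (ι → H) × (ι → ℝ)} (hy : y ∈ W) :
    ∑ i, w i * (inner ℝ (regFlux (ε i) (x.1 i)) (y.1 i) + α * (x.2 i - b i) * y.2 i) = 0 := by
  have hder : HasDerivAt (fun s : ℝ => energyReg w b α ε (x + s • y))
      (∑ i, w i * (inner ℝ (regFlux (ε i) (x.1 i)) (y.1 i) + α * (x.2 i - b i) * y.2 i)) 0 := by
    have h1 : HasDerivAt (fun s : ℝ => ∑ i, w i * fReg (ε i) ‖x.1 i + s • y.1 i‖)
        (∑ i, w i * inner ℝ (regFlux (ε i) (x.1 i)) (y.1 i)) 0 :=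
      HasDerivAt.fun_sum fun i _ => (hasDerivAt_fReg_norm (hε i) _ _).const_mul (w i)
    have h2 : HasDerivAt (fun s : ℝ => ∑ i, w i * (x.2 i + s * y.2 i - b i) ^ 2)
        (∑ i, w i * (2 * (x.2 i - b i) * y.2 i)) 0 := by
      refine HasDerivAt.fun_sum fun i _ => HasDerivAt.const_mul (w i) ?_
      have h3 := ((((hasDerivAt_id (0 : ℝ)).mul_const (y.2 i)).const_add (x.2 i)).sub_const
        (b i)).fun_pow 2
      simpa using h3
    have h4 := h1.add (h2.const_mul (α / 2))
    refine h4.congr_deriv ?_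
    rw [Finset.mul_sum, ← Finset.sum_add_distrib]
    refine Finset.sum_congr rfl fun i _ => ?_
    ring
  refine IsLocalMin.hasDerivAt_eq_zero (Eventually.of_forall fun s => ?_) hder
  have h := hmin (W.add_mem hx (W.smul_mem s hy))
  simpa using h


variable [FiniteDimensional ℝ H]

theorem exists_isMinOn_of_coercive (hw : ∀ i, 0 < w i) (hα : 0 < α)
    {J : (ι → H) × (ι → ℝ) → ℝ} (hJ : Continuous J) {κ : ℝ} (hκ : 0 < κ)
    (hlow : ∀ x, κ * (∑ i, w i * ‖x.1 i‖) + α / 2 * ∑ i, w i * (x.2 i - b i) ^ 2 ≤ J x) :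
    ∃ x ∈ W, IsMinOn J W x := by
  have hclosed : IsClosed (W : Set ((ι → H) × (ι → ℝ))) := W.closed_of_finiteDimensional
  have hcomp : IsCompact ((W : Set ((ι → H) × (ι → ℝ))) ∩ {x | J x ≤ J 0}) :=
    Metric.isCompact_of_isClosed_isBounded (hclosed.inter (isClosed_le hJ continuous_const))
      ((isBounded_sublevel hw hα hκ (J 0)).subset fun x hx => (hlow x).trans hx.2)
  obtain ⟨x, hx, hmin⟩ := hcomp.exists_isMinOn ⟨0, W.zero_mem, le_refl (J 0)⟩ hJ.continuousOn
  refine ⟨x, hx.1, fun y hy => ?_⟩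
  rcases le_total (J y) (J 0) with h | h
  · exact hmin ⟨hy, h⟩
  · exact le_trans hx.2 h

theorem exists_isMinOn_energy (hw : ∀ i, 0 < w i) (hα : 0 < α) :
    ∃ x ∈ W, IsMinOn (energy w b α) W x :=
  exists_isMinOn_of_coercive hw hα continuous_energy one_pos fun x => by rw [one_mul]; rfl

theorem exists_isMinOn_energyReg (hw : ∀ i, 0 < w i) (hα : 0 < α) {ε : ι → ℝ}
    (hε : ∀ i, ε i < 1) : ∃ x ∈ W, IsMinOn (energyReg w b α ε) W x := by
  obtain ⟨κ, hκ, hκε⟩ : ∃ κ > 0, ∀ i, κ ≤ 1 - ε i := by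
    rcases isEmpty_or_nonempty ι with h | h
    · exact ⟨1, one_pos, fun i => h.elim i⟩
    · obtain ⟨i, hi⟩ := Finite.exists_min fun i => 1 - ε i
      exact ⟨1 - ε i, by linarith [hε i], hi⟩
  exact exists_isMinOn_of_coercive hw hα (continuous_energyReg ε) hκ
    (energyReg_lower_bound hw hε hκε)

end Energy

end ROF

namespace ROF

variable {ι H : Type*} [Fintype ι] [NormedAddCommGroup H] [InnerProductSpace ℝ H]
  {w b : ι → ℝ} {α : ℝ}

/-! ### Vanishing regularization -/

/-- Minimizers of the regularized energies and their fluxes converge along a subsequence if the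
regularization parameters tend to zero; the limit flux `p` is a unit field in the direction of the
limit gradient, in the sense `p · a = |a|`, `|p| ≤ 1`, and the Euler-Lagrange equation persists. -/
theorem exists_subseq_tendsto [FiniteDimensional ℝ H] {W : Submodule ℝ ((ι → H) × (ι → ℝ))}
    (hw : ∀ i, 0 < w i) (hα : 0 < α) {ε : ℕ → ι → ℝ} (hε : ∀ k i, 0 < ε k i ∧ ε k i < 1)
    (hε0 : ∀ i, Tendsto (fun k => ε k i) atTop (𝓝 0)) {x : ℕ → (ι → H) × (ι → ℝ)}
    (hxW : ∀ k, x k ∈ W) (hmin : ∀ k, IsMinOn (energyReg w b α (ε k)) W (x k)) :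
    ∃ φ : ℕ → ℕ, StrictMono φ ∧ ∃ z ∈ W, ∃ p : ι → H, (∀ i, ‖p i‖ ≤ 1) ∧
      (∀ i, Tendsto (fun k => regFlux (ε (φ k) i) ((x (φ k)).1 i)) atTop (𝓝 (p i))) ∧
      (∀ i, Tendsto (fun k => (x (φ k)).2 i) atTop (𝓝 (z.2 i))) ∧
      (∀ i, inner ℝ (p i) (z.1 i) = ‖z.1 i‖) ∧
      ∀ y ∈ W, ∑ i, w i * (inner ℝ (p i) (y.1 i) + α * (z.2 i - b i) * y.2 i) = 0 := by
  obtain ⟨K, hK⟩ : ∃ K, ∀ k ≥ K, ∀ i, ε k i < 1 / 2 :=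
    eventually_atTop.1 (eventually_all.2 fun i => (hε0 i).eventually (gt_mem_nhds (by norm_num)))
  -- comparison with `0`, where the first part of the regularized energy is `∑ w (1 - ε) ε`
  have hbound : ∀ k ≥ K, (1 / 2 : ℝ) * (∑ i, w i * ‖(x k).1 i‖) +
      α / 2 * ∑ i, w i * ((x k).2 i - b i) ^ 2 ≤
      (∑ i, w i) + α / 2 * ∑ i, w i * (0 - b i) ^ 2 := by
    intro k hk
    refine (energyReg_lower_bound hw (fun i => (hε k i).2)
      (fun i => by linarith [hK k hk i]) (x k)).trans ((hmin k W.zero_mem).trans ?_)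
    refine add_le_add (Finset.sum_le_sum fun i _ => ?_) le_rfl
    have h1 := (hε k i).1
    have h2 := (hε k i).2
    simp only [fReg, Prod.fst_zero, Pi.zero_apply, norm_zero]
    rw [zero_pow two_ne_zero, zero_add, Real.sqrt_sq h1.le]
    have := hw i
    nlinarith [mul_nonneg (sub_nonneg.2 h2.le) (sub_nonneg.2 h2.le)]
  have hB := isBounded_sublevel (H := H) (b := b) hw hα one_half_pos
    ((∑ i, w i) + α / 2 * ∑ i, w i * (0 - b i) ^ 2)
  have hP : Bornology.IsBounded {p : ι → H | ∀ i, ‖p i‖ ≤ 1} :=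
    isBounded_iff_forall_norm_le.2 ⟨1, fun p hp => (pi_norm_le_iff_of_nonneg zero_le_one).2 hp⟩
  obtain ⟨⟨z, p⟩, -, ψ, hψ, hlim⟩ := tendsto_subseq_of_bounded (hB.prod hP)
    (x := fun k => (x (k + K), fun i => regFlux (ε (k + K) i) ((x (k + K)).1 i)))
    fun k => ⟨hbound _ (Nat.le_add_left _ _),
      fun i => norm_regFlux_le (hε _ i).1 (hε _ i).2 _⟩
  have hφ : StrictMono fun k => ψ k + K := fun k l hkl => Nat.add_lt_add_right (hψ hkl) K
  have hz : Tendsto (fun k => x (ψ k + K)) atTop (𝓝 z) := (continuous_fst.tendsto _).comp hlim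
  have hp : Tendsto (fun k i => regFlux (ε (ψ k + K) i) ((x (ψ k + K)).1 i)) atTop (𝓝 p) :=
    (continuous_snd.tendsto _).comp hlim
  have hz1 : ∀ i, Tendsto (fun k => (x (ψ k + K)).1 i) atTop (𝓝 (z.1 i)) := fun i =>
    (((continuous_apply i).comp continuous_fst).tendsto z).comp hz
  have hz2 : ∀ i, Tendsto (fun k => (x (ψ k + K)).2 i) atTop (𝓝 (z.2 i)) := fun i =>
    (((continuous_apply i).comp continuous_snd).tendsto z).comp hz
  have hpi : ∀ i, Tendsto (fun k => regFlux (ε (ψ k + K) i) ((x (ψ k + K)).1 i)) atTop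
      (𝓝 (p i)) := fun i => ((continuous_apply i).tendsto p).comp hp
  have hp1 : ∀ i, ‖p i‖ ≤ 1 := fun i => le_of_tendsto (hpi i).norm
    (Eventually.of_forall fun k => norm_regFlux_le (hε _ i).1 (hε _ i).2 _)
  refine ⟨_, hφ, z, ?_, p, hp1, hpi, hz2, fun i => ?_, fun y hy => ?_⟩
  · exact W.closed_of_finiteDimensional.mem_of_tendsto hz (Eventually.of_forall fun k => hxW _)
  · refine le_antisymm ((real_inner_le_norm _ _).trans
      (mul_le_of_le_one_left (norm_nonneg _) (hp1 i))) ?_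
    have hεφ : Tendsto (fun k => ε (ψ k + K) i) atTop (𝓝 0) := (hε0 i).comp hφ.tendsto_atTop
    have hleft : Tendsto (fun k => (1 - ε (ψ k + K) i) *
        (‖(x (ψ k + K)).1 i‖ - ε (ψ k + K) i)) atTop (𝓝 ((1 - 0) * (‖z.1 i‖ - 0))) :=
      (tendsto_const_nhds.sub hεφ).mul ((hz1 i).norm.sub hεφ)
    rw [sub_zero, sub_zero, one_mul] at hleft
    exact le_of_tendsto_of_tendsto hleft ((hpi i).inner (hz1 i))
      (Eventually.of_forall fun k => le_inner_regFlux (hε _ i).1 (hε _ i).2 _)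
  · have hsum : Tendsto (fun k => ∑ i, w i * (inner ℝ (regFlux (ε (ψ k + K) i)
        ((x (ψ k + K)).1 i)) (y.1 i) + α * ((x (ψ k + K)).2 i - b i) * y.2 i)) atTop
        (𝓝 (∑ i, w i * (inner ℝ (p i) (y.1 i) + α * (z.2 i - b i) * y.2 i))) :=
      tendsto_finsetSum _ fun i _ => (((hpi i).inner tendsto_const_nhds).add
        ((((hz2 i).sub_const _).const_mul _).mul_const _)).const_mul _
    have h0 : ∀ k, ∑ i, w i * (inner ℝ (regFlux (ε (ψ k + K) i)
        ((x (ψ k + K)).1 i)) (y.1 i) + α * ((x (ψ k + K)).2 i - b i) * y.2 i) = 0 := fun k =>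
      eulerLagrange (fun i => (hε _ i).1) (hxW _) (hmin _) hy
    simp_rw [h0] at hsum
    exact tendsto_nhds_unique hsum tendsto_const_nhds

/-! ### Duality -/

/-- The finite part of the dual energy, as a function of the divergence `s`. -/
noncomputable def dualEnergy (w b : ι → ℝ) (α : ℝ) (s : ι → ℝ) : ℝ :=
  -(1 / (2 * α)) * (∑ i, w i * (s i + α * b i) ^ 2) + α / 2 * ∑ i, w i * b i ^ 2

/-- The duality gap is a sum of nonnegative terms. -/
theorem energy_sub_dualEnergy (hα : 0 < α) {x : (ι → H) × (ι → ℝ)} {p : ι → H} {s : ι → ℝ}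
    (h : ∑ i, w i * (inner ℝ (p i) (x.1 i) + s i * x.2 i) = 0) :
    energy w b α x - dualEnergy w b α s =
      ∑ i, w i * ((‖x.1 i‖ - inner ℝ (p i) (x.1 i)) +
        1 / (2 * α) * (α * (x.2 i - b i) - s i) ^ 2) := by
  rw [← sub_zero (energy w b α x - _), ← h]
  unfold energy dualEnergy
  rw [sub_sub, sub_eq_iff_eq_add]
  simp only [Finset.mul_sum, ← Finset.sum_add_distrib]
  refine Finset.sum_congr rfl fun i _ => ?_
  field_simp
  ring

theorem gap_term_nonneg (hα : 0 < α) {a p : H} (hp : ‖p‖ ≤ 1) (t : ℝ) :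
    0 ≤ ‖a‖ - inner ℝ p a ∧ 0 ≤ 1 / (2 * α) * t ^ 2 := by
  refine ⟨sub_nonneg.2 ?_, by positivity⟩
  exact (real_inner_le_norm _ _).trans (mul_le_of_le_one_left (norm_nonneg _) hp)

theorem dualEnergy_le_energy (hw : ∀ i, 0 < w i) (hα : 0 < α) {x : (ι → H) × (ι → ℝ)} {p : ι → H}
    {s : ι → ℝ} (hp : ∀ i, ‖p i‖ ≤ 1)
    (h : ∑ i, w i * (inner ℝ (p i) (x.1 i) + s i * x.2 i) = 0) :
    dualEnergy w b α s ≤ energy w b α x := by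
  rw [← sub_nonneg, energy_sub_dualEnergy hα h]
  refine Finset.sum_nonneg fun i _ => mul_nonneg (hw i).le ?_
  have := gap_term_nonneg hα (a := x.1 i) (hp i) (α * (x.2 i - b i) - s i)
  linarith

/-- The duality gap vanishes if and only if the optimality relations hold. -/
theorem energy_eq_dualEnergy_iff (hw : ∀ i, 0 < w i) (hα : 0 < α) {x : (ι → H) × (ι → ℝ)}
    {p : ι → H} {s : ι → ℝ} (hp : ∀ i, ‖p i‖ ≤ 1)
    (h : ∑ i, w i * (inner ℝ (p i) (x.1 i) + s i * x.2 i) = 0) :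
    energy w b α x = dualEnergy w b α s ↔
      ∀ i, s i = α * (x.2 i - b i) ∧ inner ℝ (p i) (x.1 i) = ‖x.1 i‖ := by
  have hnn := fun i => gap_term_nonneg hα (a := x.1 i) (hp i) (α * (x.2 i - b i) - s i)
  rw [← sub_eq_zero, energy_sub_dualEnergy hα h, Finset.sum_eq_zero_iff_of_nonneg fun i _ =>
    mul_nonneg (hw i).le (add_nonneg (hnn i).1 (hnn i).2)]
  simp only [Finset.mem_univ, true_imp_iff]
  refine forall_congr' fun i => ?_
  rw [mul_eq_zero, or_iff_right (hw i).ne', add_eq_zero_iff_of_nonneg (hnn i).1 (hnn i).2,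
    mul_eq_zero, or_iff_right (by positivity), pow_eq_zero_iff two_ne_zero, sub_eq_zero,
    sub_eq_zero, and_comm, eq_comm, @eq_comm _ ‖x.1 i‖]

end ROF

namespace ROF.Triangulation

variable {d : ℕ} {Ω : Set (Euc d)} {𝒯 : Triangulation Ω}

/-! ### Reduction to the finite-dimensional problem -/

/-- The Crouzeix-Raviart space as a linear subspace. -/
def crSubmodule (𝒯 : Triangulation Ω) : Submodule ℝ (L1 𝒯 ℝ) where
  carrier := 𝒯.CR
  add_mem' hu hv S T T' hS hS' :=
    congrArg₂ (· + ·) (hu S T T' hS hS') (hv S T T' hS hS')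
  zero_mem' _ _ _ _ _ := rfl
  smul_mem' c _ hv S T T' hS hS' := congrArg (c • ·) (hv S T T' hS hS')

/-- An element-wise affine function is represented by its gradients and its mean values. -/
noncomputable def gradMean (𝒯 : Triangulation Ω) :
    L1 𝒯 ℝ →ₗ[ℝ] (𝒯.Elem → Euc d) × (𝒯.Elem → ℝ) where
  toFun v := (grad v, fun T => v T T.center)
  map_add' _ _ := Prod.ext (funext fun _ => map_add affineGrad _ _) rfl
  map_smul' _ _ := Prod.ext (funext fun _ => map_smul affineGrad _ _) rfl

theorem gradMean_injective : Function.Injective (gradMean 𝒯) := by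
  intro u v h
  funext T
  have h1 : affineGrad (u T) = affineGrad (v T) := congrFun (congrArg Prod.fst h) T
  have h2 : u T T.center = v T T.center := congrFun (congrArg Prod.snd h) T
  refine AffineMap.ext fun x => ?_
  have h3 := inner_sub_affineGrad (u T) x T.center
  rw [h1, inner_sub_affineGrad, h2] at h3
  linarith

/-- The image of the Crouzeix-Raviart space in the coordinates `gradMean`. -/
noncomputable def crImage (𝒯 : Triangulation Ω) :
    Submodule ℝ ((𝒯.Elem → Euc d) × (𝒯.Elem → ℝ)) :=
  (crSubmodule 𝒯).map (gradMean 𝒯)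

theorem gradMean_mem_crImage {v : L1 𝒯 ℝ} (hv : v ∈ 𝒯.CR) : gradMean 𝒯 v ∈ crImage 𝒯 :=
  ⟨v, hv, rfl⟩

theorem isMinOn_crImage_iff {J : L1 𝒯 ℝ → ℝ} {E : (𝒯.Elem → Euc d) × (𝒯.Elem → ℝ) → ℝ}
    (h : ∀ v, J v = E (gradMean 𝒯 v)) (u : L1 𝒯 ℝ) :
    IsMinOn J 𝒯.CR u ↔ IsMinOn E (crImage 𝒯) (gradMean 𝒯 u) := by
  constructor
  · rintro hu _ ⟨v, hv, rfl⟩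
    change E _ ≤ E _
    rw [← h, ← h]
    exact hu hv
  · intro hu v hv
    change J u ≤ J v
    rw [h, h]
    exact hu ⟨v, hv, rfl⟩

theorem primal_eq_energy (hΩ : interior (closure Ω) = Ω) (α : ℝ) (g : Euc d → ℝ) (v : L1 𝒯 ℝ) :
    𝒯.primal α g v = energy Elem.vol (𝒯.proj g) α (gradMean 𝒯 v) := by
  rw [primal, setIntegral_eq_sum hΩ (c := fun T => ‖grad v T‖)
      fun T x hx => by rw [toFun_L0_apply _ hx],
    setIntegral_eq_sum hΩ (c := fun T => (v T T.center - 𝒯.proj g T) ^ 2)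
      fun T x hx => by rw [toFun_L0_apply _ hx, toFun_L0_apply _ hx, proj_L1]]
  rfl

theorem primalReg_eq_energyReg (hΩ : interior (closure Ω) = Ω) (α : ℝ) (g : Euc d → ℝ)
    {ε : L0 𝒯 ℝ} (hε : ∀ T, ε T < 1) (v : L1 𝒯 ℝ) :
    𝒯.primalReg α g ε v = energyReg Elem.vol (𝒯.proj g) α ε (gradMean 𝒯 v) := by
  rw [primalReg, setIntegral_eq_sum hΩ (c := fun T => fReg (ε T) ‖grad v T‖)
      fun T x hx => by
        rw [toFun_L0_apply _ hx, toFun_L0_apply _ hx, abs_of_nonneg (fReg_nonneg (hε T) _)],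
    setIntegral_eq_sum hΩ (c := fun T => (v T T.center - 𝒯.proj g T) ^ 2)
      fun T x hx => by rw [toFun_L0_apply _ hx, toFun_L0_apply _ hx, proj_L1]]
  rfl

theorem ae_norm_toFun_le_iff (hΩ : interior (closure Ω) = Ω) (a : L0 𝒯 (Euc d)) :
    (∀ᵐ x ∂(volume.restrict Ω), ‖a.toFun x‖ ≤ 1) ↔ ∀ T, ‖a T‖ ≤ 1 := by
  constructor
  · intro h T
    obtain ⟨x, hx, hx1⟩ := exists_mem_interior_of_ae hΩ h T
    rwa [toFun_L0_apply _ hx] at hx1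
  · intro h
    exact ae_of_forall_interior hΩ fun T x hx => by rw [toFun_L0_apply _ hx]; exact h T

theorem dual_rtField_of_le (hΩ : interior (closure Ω) = Ω) (α : ℝ) (g : Euc d → ℝ)
    {a : L0 𝒯 (Euc d)} (c : L0 𝒯 ℝ) (ha : ∀ T, ‖a T‖ ≤ 1) :
    𝒯.dual α g (rtField a c) = (dualEnergy Elem.vol (𝒯.proj g) α fun T => d * c T : ℝ) := by
  rw [dual, proj_rtField, unitBallIndicator, if_pos ((ae_norm_toFun_le_iff hΩ a).2 ha), neg_zero,
    zero_add,
    setIntegral_eq_sum hΩ (c := fun T => (d * c T + α * 𝒯.proj g T) ^ 2)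
      fun T x hx => by rw [toFun_L0_apply _ hx, toFun_L0_apply _ hx, div_rtField],
    setIntegral_eq_sum hΩ (c := fun T => 𝒯.proj g T ^ 2)
      fun T x hx => by rw [toFun_L0_apply _ hx]]
  rfl

theorem dual_rtField_of_not_le (hΩ : interior (closure Ω) = Ω) (α : ℝ) (g : Euc d → ℝ)
    {a : L0 𝒯 (Euc d)} (c : L0 𝒯 ℝ) (ha : ¬∀ T, ‖a T‖ ≤ 1) :
    𝒯.dual α g (rtField a c) = ⊥ := by
  rw [dual, proj_rtField, unitBallIndicator, if_neg (mt (ae_norm_toFun_le_iff hΩ a).1 ha),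
    EReal.neg_top, EReal.bot_add]

theorem pairing_eq_sum_gradMean (a : L0 𝒯 (Euc d)) (c : L0 𝒯 ℝ) (v : L1 𝒯 ℝ) :
    pairing a c v = ∑ T : 𝒯.Elem, T.vol * (inner ℝ (a T) ((gradMean 𝒯 v).1 T) +
      d * c T * (gradMean 𝒯 v).2 T) := rfl

theorem sum_gradMean_eq_zero (hd : 1 ≤ d) {a : L0 𝒯 (Euc d)} {c : L0 𝒯 ℝ}
    (hy : rtField a c ∈ 𝒯.RTN) {v : L1 𝒯 ℝ} (hv : v ∈ 𝒯.CR) :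
    ∑ T : 𝒯.Elem, T.vol * (inner ℝ (a T) ((gradMean 𝒯 v).1 T) +
      d * c T * (gradMean 𝒯 v).2 T) = 0 :=
  (rtField_mem_RTN_iff hd a c).1 hy v hv

/-- Weak duality. -/
theorem dual_le_primal (hd : 1 ≤ d) (hΩ : interior (closure Ω) = Ω) {α : ℝ} (hα : 0 < α)
    (g : Euc d → ℝ) {y : L1 𝒯 (Euc d)} (hy : y ∈ 𝒯.RTN) {v : L1 𝒯 ℝ} (hv : v ∈ 𝒯.CR) :
    𝒯.dual α g y ≤ (𝒯.primal α g v : ℝ) := by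
  obtain ⟨a, c, rfl⟩ := exists_eq_rtField_of_mem_RTN hd hy
  by_cases ha : ∀ T, ‖a T‖ ≤ 1
  · rw [dual_rtField_of_le hΩ α g c ha, primal_eq_energy hΩ, EReal.coe_le_coe_iff]
    exact dualEnergy_le_energy Elem.vol_pos hα ha (sum_gradMean_eq_zero hd hy hv)
  · rw [dual_rtField_of_not_le hΩ α g c ha]
    exact bot_le

/-- Uniform convergence of element-wise constant functions controls each of their values. -/
theorem tendsto_of_tendsto_eLpNorm_top (hΩ : interior (closure Ω) = Ω) {ε : ℕ → L0 𝒯 ℝ}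
    (h : Tendsto (fun k => eLpNorm (ε k).toFun ⊤ (volume.restrict Ω)) atTop (𝓝 0)) (T : 𝒯.Elem) :
    Tendsto (fun k => ε k T) atTop (𝓝 0) := by
  have hle : ∀ k, ‖ε k T‖ₑ ≤ eLpNorm (ε k).toFun ⊤ (volume.restrict Ω) := by
    intro k
    obtain ⟨x, hx, hx1⟩ := exists_mem_interior_of_ae hΩ
      (enorm_ae_le_eLpNormEssSup (ε k).toFun (volume.restrict Ω)) T
    rw [toFun_L0_apply _ hx] at hx1
    rwa [eLpNorm_exponent_top]
  rw [tendsto_zero_iff_enorm_tendsto_zero]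
  exact tendsto_of_tendsto_of_tendsto_of_le_of_le tendsto_const_nhds h (fun _ => zero_le) hle

theorem tendsto_eLpNorm_rtField_sub (hΩ : interior (closure Ω) = Ω) {a : ℕ → L0 𝒯 (Euc d)}
    {c : ℕ → L0 𝒯 ℝ} {a' : L0 𝒯 (Euc d)} {c' : L0 𝒯 ℝ}
    (ha : ∀ T, Tendsto (fun k => a k T) atTop (𝓝 (a' T)))
    (hc : ∀ T, Tendsto (fun k => c k T) atTop (𝓝 (c' T))) :
    Tendsto (fun k => eLpNorm (fun x => (rtField (a k) (c k)).toFun x - (rtField a' c').toFun x)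
      ⊤ (volume.restrict Ω)) atTop (𝓝 0) := by
  have hR : ∀ T : 𝒯.Elem, ∃ R, ∀ x ∈ T.carrier, ‖x - T.center‖ ≤ R := by
    intro T
    obtain ⟨R, hR⟩ := isBounded_iff_forall_norm_le.1 T.isCompact_carrier.isBounded
    exact ⟨R + ‖T.center‖, fun x hx => (norm_sub_le _ _).trans (by linarith [hR x hx])⟩
  choose R hR using hR
  let B : ℕ → ℝ := fun k => ∑ T : 𝒯.Elem, (‖a k T - a' T‖ + ‖c k T - c' T‖ * |R T|)
  have hB : Tendsto B atTop (𝓝 0) := by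
    have : Tendsto B atTop (𝓝 (∑ T : 𝒯.Elem, (‖a' T - a' T‖ + ‖c' T - c' T‖ * |R T|))) :=
      tendsto_finsetSum _ fun T _ => (((ha T).sub_const _).norm).add
        ((((hc T).sub_const _).norm).mul_const _)
    simpa using this
  have hle : ∀ k, eLpNorm (fun x => (rtField (a k) (c k)).toFun x - (rtField a' c').toFun x)
      ⊤ (volume.restrict Ω) ≤ ENNReal.ofReal (B k) := by
    intro k
    rw [eLpNorm_exponent_top]
    refine eLpNormEssSup_le_of_ae_bound (ae_of_forall_interior (𝒯 := 𝒯) hΩ fun T x hx => ?_)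
    rw [toFun_L1_apply _ hx, toFun_L1_apply _ hx, rtField_apply, rtField_apply]
    have h1 : a k T + c k T • (x - T.center) - (a' T + c' T • (x - T.center)) =
        (a k T - a' T) + (c k T - c' T) • (x - T.center) := by
      rw [sub_smul]; abel
    rw [h1]
    refine (norm_add_le _ _).trans ?_
    rw [norm_smul]
    have h2 : ‖a k T - a' T‖ + ‖c k T - c' T‖ * |R T| ≤ B k :=
      Finset.single_le_sum (f := fun T => ‖a k T - a' T‖ + ‖c k T - c' T‖ * |R T|)
        (fun _ _ => by positivity) (Finset.mem_univ T)
    have h3 := (hR T x (interior_subset hx)).trans (le_abs_self _)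
    have h4 := mul_le_mul_of_nonneg_left h3 (norm_nonneg (c k T - c' T))
    linarith
  have hB' := ENNReal.tendsto_ofReal hB
  rw [ENNReal.ofReal_zero] at hB'
  exact tendsto_of_tendsto_of_tendsto_of_le_of_le tendsto_const_nhds hB' (fun _ => zero_le) hle

end ROF.Triangulation

open ROF

theorem theorem4p8 {d : ℕ} (hd : 1 ≤ d) (Ω : Set (Euc d)) (hΩ : interior (closure Ω) = Ω)
    (𝒯 : Triangulation Ω) (g : Euc d → ℝ) (hg : MemLp g 2 (volume.restrict Ω))
    (α : ℝ) (hα : 0 < α) :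
    -- the minimizers `u_h` and `u_{h,ε}` exist, the latter uniquely
    (∃ u ∈ 𝒯.CR, IsMinOn (𝒯.primal α g) 𝒯.CR u) ∧
    (∀ ε : 𝒯.L0 ℝ, (∀ T, 0 < ε T ∧ ε T < 1) →
      ∃! u, u ∈ 𝒯.CR ∧ IsMinOn (𝒯.primalReg α g ε) 𝒯.CR u) ∧
    -- for every sequence of regularization parameters which tends to zero uniformly
    ∀ (ε : ℕ → 𝒯.L0 ℝ) (uε : ℕ → 𝒯.L1 ℝ),
      (∀ k T, 0 < ε k T ∧ ε k T < 1) →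
      Tendsto (fun k => eLpNorm (ε k).toFun ⊤ (volume.restrict Ω)) atTop (𝓝 0) →
      (∀ k, uε k ∈ 𝒯.CR ∧ IsMinOn (𝒯.primalReg α g (ε k)) 𝒯.CR (uε k)) →
      ∃ z ∈ 𝒯.RTN,
        (∀ᵐ x ∂(volume.restrict Ω), ‖(𝒯.proj z.toFun).toFun x‖ ≤ 1) ∧
        -- (i) convergence of a subsequence of the Marini reconstructions
        (∀ k, 𝒯.marini α g (ε k) (uε k) ∈ 𝒯.RTN) ∧
        (∃ φ : ℕ → ℕ, StrictMono φ ∧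
          Tendsto (fun k => eLpNorm
            (fun x => (𝒯.marini α g (ε (φ k)) (uε (φ k))).toFun x - z.toFun x)
            ⊤ (volume.restrict Ω)) atTop (𝓝 0)) ∧
        -- (iii) maximality
        IsMaxOn (𝒯.dual α g) 𝒯.RTN z ∧
        ∀ u ∈ 𝒯.CR, IsMinOn (𝒯.primal α g) 𝒯.CR u →
          -- (ii) optimality relations
          (∀ T, Triangulation.div z T = α * (𝒯.proj u.toFun T - 𝒯.proj g T)) ∧
          (∀ T, inner ℝ (𝒯.proj z.toFun T) (Triangulation.grad u T) = ‖Triangulation.grad u T‖) ∧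
          -- (iii) strong duality
          ((𝒯.primal α g u : ℝ) : EReal) = 𝒯.dual α g z := by
  have hd0 : (d : ℝ) ≠ 0 := by positivity
  have hw : ∀ T : 𝒯.Elem, 0 < T.vol := Triangulation.Elem.vol_pos
  have hprimal := Triangulation.isMinOn_crImage_iff (Triangulation.primal_eq_energy (𝒯 := 𝒯) hΩ α g)
  have hreg := fun (ε : 𝒯.L0 ℝ) (hε : ∀ T, 0 < ε T ∧ ε T < 1) =>
    Triangulation.isMinOn_crImage_iff
      (Triangulation.primalReg_eq_energyReg hΩ α g fun T => (hε T).2)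
  refine ⟨?_, fun ε hε => ?_, fun ε uε hε hε0 hu => ?_⟩
  · obtain ⟨_, ⟨u, hu, rfl⟩, hmin⟩ := exists_isMinOn_energy (W := 𝒯.crImage) (b := 𝒯.proj g) hw hα
    exact ⟨u, hu, (hprimal u).2 hmin⟩
  · obtain ⟨_, ⟨u, hu, rfl⟩, hmin⟩ :=
      exists_isMinOn_energyReg (W := 𝒯.crImage) (b := 𝒯.proj g) hw hα fun T => (hε T).2
    refine ⟨u, ⟨hu, (hreg ε hε u).2 hmin⟩, fun v hv => Triangulation.gradMean_injective ?_⟩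
    exact eq_of_isMinOn_energyReg hw hα hε (Triangulation.gradMean_mem_crImage hv.1)
      (Triangulation.gradMean_mem_crImage hu) ((hreg ε hε v).1 hv.2) hmin
  obtain ⟨φ, hφ, _, ⟨ū, hū, rfl⟩, p, hp, hplim, hmlim, hpa, horth⟩ :=
    exists_subseq_tendsto (W := 𝒯.crImage) (b := 𝒯.proj g) hw hα hε
      (Triangulation.tendsto_of_tendsto_eLpNorm_top hΩ hε0)
      (fun k => Triangulation.gradMean_mem_crImage (hu k).1) fun k => (hreg _ (hε k) _).1 (hu k).2
  let c : 𝒯.L0 ℝ := fun T => α * ((ū T T.center - 𝒯.proj g T) / d)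
  have hdc : ∀ T, d * c T = α * (ū T T.center - 𝒯.proj g T) := fun T => by
    simp only [c]; field_simp
  have hmarini : ∀ k, 𝒯.marini α g (ε k) (uε k) = Triangulation.rtField
      (fun T => regFlux (ε k T) (Triangulation.grad (uε k) T))
      (fun T => α * ((uε k T T.center - 𝒯.proj g T) / d)) := fun k => by
    rw [Triangulation.marini_eq_rtField]
    simp_rw [deriv_fReg_smul (hε k _).1]
  have hz : Triangulation.rtField p c ∈ 𝒯.RTN := by
    rw [Triangulation.rtField_mem_RTN_iff hd]
    intro v hv
    rw [Triangulation.pairing_eq_sum_gradMean]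
    simp_rw [hdc]
    exact horth _ (Triangulation.gradMean_mem_crImage hv)
  have hdual := Triangulation.dual_rtField_of_le hΩ α g c hp
  -- there is no duality gap, as the limits satisfy the optimality relations
  have hstrong : 𝒯.primal α g ū =
      dualEnergy Triangulation.Elem.vol (𝒯.proj g) α fun T => d * c T := by
    rw [Triangulation.primal_eq_energy hΩ]
    exact (energy_eq_dualEnergy_iff hw hα hp (Triangulation.sum_gradMean_eq_zero hd hz hū)).2
      fun T => ⟨hdc T, hpa T⟩
  refine ⟨Triangulation.rtField p c, hz, ?_, fun k => ?_, ⟨φ, hφ, ?_⟩, fun y hy => ?_,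
    fun u hu' humin => ?_⟩
  · rw [Triangulation.proj_rtField]
    exact (Triangulation.ae_norm_toFun_le_iff hΩ p).2 hp
  · rw [hmarini, Triangulation.rtField_mem_RTN_iff hd]
    intro v hv
    have h := eulerLagrange (fun T => (hε k T).1) (Triangulation.gradMean_mem_crImage (hu k).1)
      ((hreg _ (hε k) _).1 (hu k).2) (Triangulation.gradMean_mem_crImage hv)
    rw [← h, Triangulation.pairing_eq_sum_gradMean]
    refine Finset.sum_congr rfl fun T _ => ?_
    have : (d : ℝ) * (α * ((uε k T T.center - 𝒯.proj g T) / d)) =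
        α * (uε k T T.center - 𝒯.proj g T) := by field_simp
    rw [this]
    rfl
  · simp_rw [hmarini]
    exact Triangulation.tendsto_eLpNorm_rtField_sub hΩ hplim fun T =>
      ((hmlim T).sub_const _).div_const _ |>.const_mul α
  · change 𝒯.dual α g y ≤ 𝒯.dual α g (Triangulation.rtField p c)
    rw [hdual, ← hstrong]
    exact Triangulation.dual_le_primal hd hΩ hα g hy hū
  · have hle : 𝒯.primal α g u ≤ 𝒯.primal α g ū := humin hū
    have hge : dualEnergy Triangulation.Elem.vol (𝒯.proj g) α (fun T => d * c T) ≤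
        𝒯.primal α g u := by
      have h := Triangulation.dual_le_primal hd hΩ hα g hz hu'
      rwa [hdual, EReal.coe_le_coe_iff] at h
    have heq := le_antisymm (hle.trans hstrong.le) hge
    have hopt := (energy_eq_dualEnergy_iff hw hα hp
      (Triangulation.sum_gradMean_eq_zero hd hz hu')).1
        ((Triangulation.primal_eq_energy hΩ α g u).symm.trans heq)
    refine ⟨fun T => ?_, fun T => ?_, by rw [hdual, heq]⟩
    · rw [Triangulation.div_rtField, Triangulation.proj_L1]
      exact (hopt T).1
    · rw [Triangulation.proj_rtField]
      exact (hopt T).2
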